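/- Let $\mathcal G$ be a second countable, locally compact, Hausdorff étale groupoid with unit space $\mathcal G^{(0)}$, range and source maps $r,s$, and let $c:\mathcal G\to\mathbb R$ be a continuous homomorphism. Let $C^*_r(\mathcal G)$ be the reduced groupoid $C^*$-algebra, i.e. the completion of the convolution $*$-algebra $C_c(\mathcal G)$ in the norm $\|f\|_r=\sup_{x}\|\pi_x(f)\|$, where $\pi_x$ is the representation $(\pi_x(f)\xi)(g)=\sum_{h\in r^{-1}(r(g))}f(h)\xi(h^{-1}g)$ on $\ell^2(s^{-1}(x))$. Let $P:C^*_r(\mathcal G)\to C_0(\mathcal G^{(0)})$ be the conditional expectation extending the restriction map $C_c(\mathcal G)\to C_c(\mathcal G^{(0)})$. Let $\sigma^c=(\sigma^c_t)_{t\in\mathbb R}$ be the continuous one-parameter group of automorphisms of $C^*_r(\mathcal G)$ with $\sigma^c_t(f)(g)=e^{itc(g)}f(g)$ for $f\in C_c(\mathcal G)$; for $z\in\mathbb C$ and $f\in C_c(\mathcal G)$ put $\sigma^c_z(f)(g)=e^{izc(g)}f(g)$. For a weight $\psi$ on a $C^*$-algebra $A$ put $\mathcal N_\psi=\{a\in A:\psi(a^*a)<\infty\}$.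 If $\psi$ is proper (non-zero, densely defined and lower semi-continuous), denote also by $\psi$ its unique linear extension to $\mathcal N_\psi^*\mathcal N_\psi=\operatorname{Span}\{a^*b:a,b\in\mathcal N_\psi\}$. A proper weight $\psi$ is a $\beta$-KMS weight for a point-wise norm-continuous one-parameter group $\alpha$ of automorphisms of $A$ if $\psi\circ\alpha_t=\psi$ for all $t\in\mathbb R$ and for all $a,b\in\mathcal N_\psi\cap\mathcal N_\psi^*$ there is a continuous bounded function $F$ on the closed strip of all $z\in\mathbb C$ with imaginary part between $0$ and $\beta$, holomorphic in the interior of the strip, such that $F(t)=\psi(a\alpha_t(b))$ and $F(t+i\beta)=\psi(\alpha_t(b)a)$ for all $t\in\mathbb R$. Let $\beta\in\mathbb R$, let $m$ be a non-zero regular Borel measure on $\mathcal G^{(0)}$ (in particular finite on compact sets), and let $\varphi_m$ be the weight $\varphi_m(a)=\int_{\mathcal G^{(0)}}P(a)\,dm$, $a\in C^*_r(\mathcal G)_+$. Then the following are equivalent: 1. $m$ is $(\mathcal G,c)$-conformal with exponent $\beta$, i.e. $m(s(W))=\int_{r(W)}e^{\beta c(r_W^{-1}(x))}\,dm(x)$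 for every open bisection $W\subseteq\mathcal G$, where $r_W^{-1}$ is the inverse of $r:W\to r(W)$. 2. For all $f,g\in C_c(\mathcal G)$ the elements $fg$ and $g\,\sigma^c_{i\beta}(f)$ lie in $\mathcal N_{\varphi_m}^*\mathcal N_{\varphi_m}$, and $\varphi_m(fg)=\varphi_m\big(g\,\sigma^c_{i\beta}(f)\big)$. 3. $\varphi_m$ is a $\beta$-KMS weight for $\sigma^c$. -/

import Mathlib

open Set Filter Topology MeasureTheory
open scoped ENNReal NNReal CompactlySupported

/-! ### Weights and KMS weights on C*-algebras -/

namespace CStarWeight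

variable {A : Type*} [NonUnitalCStarAlgebra A]

/-- The cone `A₊` of positive elements of a C*-algebra. -/
def posCone (A : Type*) [NonUnitalCStarAlgebra A] : Set A := {a | ∃ b : A, a = star b * b}

/-- `ψ` is a weight. A weight is a map `A₊ → [0, ∞]`; it is represented here by a function on `A`
of which only the values on `A₊` are ever used. -/
structure IsWeight (ψ : A → ℝ≥0∞) : Prop where
  map_add : ∀ a ∈ posCone A, ∀ b ∈ posCone A, ψ (a + b) = ψ a + ψ b
  map_smul : ∀ l : ℝ, 0 < l → ∀ a ∈ posCone A, ψ ((l : ℂ) • a) = ENNReal.ofReal l * ψ a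

/-- A proper weight: non-zero, densely defined and lower semi-continuous. -/
structure IsProper (ψ : A → ℝ≥0∞) : Prop extends IsWeight ψ where
  nonzero : ∃ a ∈ posCone A, ψ a ≠ 0
  dense : posCone A ⊆ closure {a | a ∈ posCone A ∧ ψ a < ∞}
  lsc : ∀ r : ℝ≥0, IsClosed {a | a ∈ posCone A ∧ ψ a ≤ r}

/-- `𝒩_ψ = {a | ψ(a* a) < ∞}`. -/
def N (ψ : A → ℝ≥0∞) : Set A := {a | ψ (star a * a) < ∞}

/-- `𝒩_ψ* 𝒩_ψ`, the linear span of the products `a* b` with `a, b ∈ 𝒩_ψ`. -/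
def NstarN (ψ : A → ℝ≥0∞) : Submodule ℂ A :=
  Submodule.span ℂ {x | ∃ a ∈ N ψ, ∃ b ∈ N ψ, x = star a * b}

open Classical in
/-- The linear functional on `𝒩_ψ* 𝒩_ψ` which extends the weight `ψ` from `𝒩_ψ* 𝒩_ψ ∩ A₊`. For a
proper weight it exists and is unique. -/
noncomputable def linExt (ψ : A → ℝ≥0∞) : NstarN ψ →ₗ[ℂ] ℂ :=
  if h : ∃ L : NstarN ψ →ₗ[ℂ] ℂ, ∀ x : NstarN ψ, (x : A) ∈ posCone A →
      ψ x < ∞ ∧ L x = ((ψ x).toReal : ℂ)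
  then h.choose else 0

open Classical in
/-- The value at `x` of the linear extension of `ψ`; it is only meaningful for `x ∈ 𝒩_ψ* 𝒩_ψ`. -/
noncomputable def ext (ψ : A → ℝ≥0∞) (x : A) : ℂ :=
  if h : x ∈ NstarN ψ then linExt ψ ⟨x, h⟩ else 0

/-- A point-wise norm-continuous one-parameter group of automorphisms of `A`. -/
structure OneParamGroup (A : Type*) [NonUnitalCStarAlgebra A] where
  aut : ℝ → A ≃⋆ₐ[ℂ] A
  aut_zero : ∀ a, aut 0 a = a
  aut_add : ∀ s t a, aut (s + t) a = aut s (aut t a)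
  continuous_aut : ∀ a, Continuous fun t => aut t a

/-- The closed strip of complex numbers whose imaginary part lies between `0` and `β`
(`β` may be negative or zero). -/
def strip (β : ℝ) : Set ℂ := {z | z.im ∈ Set.uIcc 0 β}

/-- `ψ` is a `β`-KMS weight for `α`. The arguments of `ext ψ` below lie in `𝒩_ψ* 𝒩_ψ`, see
`IsKMSWeight.mul_mem`. -/
structure IsKMSWeight (β : ℝ) (α : OneParamGroup A) (ψ : A → ℝ≥0∞) : Prop extends
    IsProper ψ where
  invariant : ∀ t, ∀ a ∈ posCone A, ψ (α.aut t a) = ψ a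
  kms : ∀ a b : A, a ∈ N ψ → star a ∈ N ψ → b ∈ N ψ → star b ∈ N ψ →
    ∃ F : ℂ → ℂ, ContinuousOn F (strip β) ∧ (∃ C : ℝ, ∀ z ∈ strip β, ‖F z‖ ≤ C) ∧
      DifferentiableOn ℂ F (interior (strip β)) ∧
      ∀ t : ℝ, F t = ext ψ (a * α.aut t b) ∧ F (t + β * Complex.I) = ext ψ (α.aut t b * a)

theorem IsKMSWeight.mul_mem {β : ℝ} {α : OneParamGroup A} {ψ : A → ℝ≥0∞}
    (h : IsKMSWeight β α ψ) {a b : A} (ha : a ∈ N ψ) (ha' : star a ∈ N ψ) (hb : b ∈ N ψ)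
    (hb' : star b ∈ N ψ) (t : ℝ) :
    a * α.aut t b ∈ NstarN ψ ∧ α.aut t b * a ∈ NstarN ψ := by
  have key : ∀ d ∈ N ψ, α.aut t d ∈ N ψ := by
    intro d hd
    have := h.invariant t (star d * d) ⟨d, rfl⟩
    rw [map_mul, map_star] at this
    simpa [N, this] using hd
  refine ⟨Submodule.subset_span ⟨star a, ha', α.aut t b, key b hb, by simp⟩,
    Submodule.subset_span ⟨star (α.aut t b), ?_, a, ha, by simp⟩⟩
  rw [← map_star]
  exact key _ hb'

end CStarWeight

/-! ### Étale groupoids -/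

/-- An étale groupoid `G` with unit space `X`, identified with the subspace of units of `G` through
`unit` (which is a topological embedding, since `r` is continuous and `r ∘ unit = id`). The product `mul g h` is only meaningful for composable pairs,
i.e. when `s g = r h`. -/
structure EtaleGroupoid (G X : Type*) [TopologicalSpace G] [TopologicalSpace X] where
  r : G → X
  s : G → X
  unit : X → G
  inv : G → G
  mul : G → G → G
  r_unit : ∀ x, r (unit x) = x
  s_unit : ∀ x, s (unit x) = x
  r_inv : ∀ g, r (inv g) = s g
  s_inv : ∀ g, s (inv g) = r g
  r_mul : ∀ g h, s g = r h → r (mul g h) = r g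
  s_mul : ∀ g h, s g = r h → s (mul g h) = s h
  mul_assoc : ∀ g h k, s g = r h → s h = r k → mul (mul g h) k = mul g (mul h k)
  unit_mul : ∀ g, mul (unit (r g)) g = g
  mul_unit : ∀ g, mul g (unit (s g)) = g
  inv_mul : ∀ g, mul (inv g) g = unit (s g)
  mul_inv : ∀ g, mul g (inv g) = unit (r g)
  continuous_s : Continuous s
  continuous_unit : Continuous unit
  continuous_inv : Continuous inv
  continuous_mul : ContinuousOn (fun p : G × G => mul p.1 p.2) {p | s p.1 = r p.2}
  isLocalHomeomorph_r : IsLocalHomeomorph r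

namespace EtaleGroupoid

variable {G X : Type*} [TopologicalSpace G] [TopologicalSpace X] (𝒢 : EtaleGroupoid G X)

theorem inv_mul_cancel_left (h g : G) (e : 𝒢.s h = 𝒢.r g) :
    𝒢.mul (𝒢.inv h) (𝒢.mul h g) = g := by
  rw [← 𝒢.mul_assoc _ _ _ (𝒢.s_inv h) e, 𝒢.inv_mul, e, 𝒢.unit_mul]

theorem mul_inv_cancel_left (h g : G) (e : 𝒢.r h = 𝒢.r g) :
    𝒢.mul h (𝒢.mul (𝒢.inv h) g) = g := by
  rw [← 𝒢.mul_assoc _ _ _ (𝒢.r_inv h).symm ((𝒢.s_inv h).trans e), 𝒢.mul_inv, e, 𝒢.unit_mul]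

theorem inv_inv (g : G) : 𝒢.inv (𝒢.inv g) = g := by
  have := 𝒢.inv_mul_cancel_left (𝒢.inv g) g (𝒢.s_inv g)
  rw [𝒢.inv_mul] at this
  have h2 := 𝒢.mul_unit (𝒢.inv (𝒢.inv g))
  rw [𝒢.s_inv, 𝒢.r_inv] at h2
  rw [← h2, this]

theorem isLocalHomeomorph_s : IsLocalHomeomorph 𝒢.s := by
  let e : G ≃ₜ G :=
    { toFun := 𝒢.inv, invFun := 𝒢.inv, left_inv := 𝒢.inv_inv, right_inv := 𝒢.inv_inv,
      continuous_toFun := 𝒢.continuous_inv, continuous_invFun := 𝒢.continuous_inv }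
  have h := 𝒢.isLocalHomeomorph_r.comp e.isLocalHomeomorph
  have h2 : 𝒢.r ∘ e = 𝒢.s := funext fun g => 𝒢.r_inv g
  rwa [h2] at h

/-- Over each point, the number of elements of a compact set is bounded by a constant. -/
theorem exists_fiber_bound {p : G → X} (hp : IsLocalHomeomorph p) {K : Set G}
    (hK : IsCompact K) :
    ∃ n : ℕ, ∀ x, {h | h ∈ K ∧ p h = x}.Finite ∧ {h | h ∈ K ∧ p h = x}.ncard ≤ n := by
  choose e he hpe using hp
  obtain ⟨t, -, ht⟩ := hK.elim_nhds_subcover (fun g => (e g).source)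
    (fun g _ => (e g).open_source.mem_nhds (he g))
  refine ⟨t.card, fun x => ?_⟩
  have hch : ∀ h : G, ∃ i, h ∈ K → i ∈ t ∧ h ∈ (e i).source := by
    intro h
    by_cases hh : h ∈ K
    · obtain ⟨i, hi, hi'⟩ := Set.mem_iUnion₂.1 (ht hh)
      exact ⟨i, fun _ => ⟨hi, hi'⟩⟩
    · exact ⟨h, fun h' => absurd h' hh⟩
  choose i hi using hch
  have hmaps : Set.MapsTo i {h | h ∈ K ∧ p h = x} (t : Set G) := fun h hh => (hi h hh.1).1
  have hinj : Set.InjOn i {h | h ∈ K ∧ p h = x} := by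
    intro a ha b hb hab
    have h1 := (hi a ha.1).2
    have h2 := (hi b hb.1).2
    rw [← hab] at h2
    refine (e (i a)).injOn h1 h2 ?_
    rw [← hpe (i a), ha.2, hb.2]
  refine ⟨Set.Finite.of_injOn hmaps hinj t.finite_toSet, ?_⟩
  have := Set.ncard_le_ncard_of_injOn i hmaps hinj t.finite_toSet
  rwa [Set.ncard_coe_finset] at this

/-- The Hilbert space `ℓ²(G)`, which is the orthogonal direct sum of the Hilbert spaces `ℓ²(G_x)`,
`G_x = s⁻¹(x)`, over all units `x`. -/
abbrev L2 (G : Type*) : Type _ := lp (fun _ : G => ℂ) 2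

/-- The value `∑_{h ∈ G^{r(g)}} f(h) ψ(h⁻¹ g)`. -/
noncomputable def conv (f ψ : G → ℂ) (g : G) : ℂ :=
  ∑' h : {h : G // 𝒢.r h = 𝒢.r g}, f h * ψ (𝒢.mul (𝒢.inv h) g)

/-- The number `n` of `exists_fiber_bound` bounds sums over the elements of `K` above a point. -/
theorem tsum_indicator_le {G X : Type*} {p : G → X} {K : Set G} {n : ℕ} {x : X}
    (h : {h | h ∈ K ∧ p h = x}.Finite ∧ {h | h ∈ K ∧ p h = x}.ncard ≤ n) (a : ℝ≥0∞) :
    ∑' h : {h : G // p h = x}, K.indicator (fun _ => a) (h : G) ≤ n * a := by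
  classical
  have h1 : (∑' h : {h : G // p h = x}, K.indicator (fun _ => a) (h : G))
      = ∑' h : G, {h | h ∈ K ∧ p h = x}.indicator (fun _ => a) h := by
    have := tsum_subtype {h : G | p h = x} (K.indicator (fun _ => a))
    refine Eq.trans this (tsum_congr fun h => ?_)
    rw [Set.indicator_indicator]
    congr 1
    ext; simp [and_comm]
  rw [h1, tsum_eq_sum (s := h.1.toFinset)]
  · calc _ ≤ ∑ b ∈ h.1.toFinset, a := Finset.sum_le_sum fun b _ => Set.indicator_le_self _ _ _
      _ = (h.1.toFinset.card : ℝ≥0∞) * a := by simp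
      _ ≤ _ := by
        gcongr
        rw [← Set.ncard_eq_toFinset_card _ h.1]; exact h.2
  · intro b hb
    exact Set.indicator_of_notMem (by simpa using hb) _

theorem summable_conv {f : G → ℂ} {K : Set G} (hK : IsCompact K) (hf : ∀ h, h ∉ K → f h = 0)
    (ψ : G → ℂ) (g : G) :
    (Function.support fun h : {h : G // 𝒢.r h = 𝒢.r g} =>
      f h * ψ (𝒢.mul (𝒢.inv h) g)).Finite := by
  obtain ⟨n, hn⟩ := exists_fiber_bound 𝒢.isLocalHomeomorph_r hK
  refine Set.Finite.of_finite_image (f := Subtype.val) ((hn (𝒢.r g)).1.subset ?_)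
    Subtype.val_injective.injOn
  rintro _ ⟨⟨h, hr⟩, hh, rfl⟩
  refine ⟨?_, hr⟩
  by_contra hK'
  exact hh (by simp [hf h hK'])

theorem enorm_conv_sq_le {f : G → ℂ} {K : Set G} (hK : IsCompact K) (hf : ∀ h, h ∉ K → f h = 0)
    {M : ℝ≥0} (hM : ∀ h, ‖f h‖₊ ≤ M) {n : ℕ}
    (hn : ∀ x, {h | h ∈ K ∧ 𝒢.r h = x}.Finite ∧ {h | h ∈ K ∧ 𝒢.r h = x}.ncard ≤ n)
    (ψ : G → ℂ) (g : G) :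
    ‖𝒢.conv f ψ g‖ₑ ^ 2 ≤ n * M ^ 2 * ∑' h : {h : G // 𝒢.r h = 𝒢.r g},
      K.indicator (fun h => ‖ψ (𝒢.mul (𝒢.inv h) g)‖ₑ ^ 2) (h : G) := by
  classical
  set F := (𝒢.summable_conv hK hf ψ g).toFinset with hF
  have hsum : 𝒢.conv f ψ g = ∑ h ∈ F, f h * ψ (𝒢.mul (𝒢.inv h) g) := by
    apply tsum_eq_sum
    intro b hb
    by_contra h0
    exact hb (by simpa [hF, Function.mem_support] using h0)
  have hFK : ∀ h ∈ F, (h : G) ∈ K := by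
    intro h hh
    by_contra h'
    simp [hF, hf _ h'] at hh
  have hcard : F.card ≤ n := by
    refine le_trans ?_ (hn (𝒢.r g)).2
    rw [← Set.ncard_coe_finset, ← Set.ncard_image_of_injective _ Subtype.val_injective]
    refine Set.ncard_le_ncard ?_ (hn _).1
    rintro _ ⟨h, hh, rfl⟩
    exact ⟨hFK h hh, h.2⟩
  have hreal : ‖𝒢.conv f ψ g‖₊ ^ 2
      ≤ n * M ^ 2 * ∑ h ∈ F, ‖ψ (𝒢.mul (𝒢.inv h) g)‖₊ ^ 2 := by
    rw [hsum]
    calc _ ≤ (∑ h ∈ F, M * ‖ψ (𝒢.mul (𝒢.inv h) g)‖₊) ^ 2 := by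
            gcongr
            refine (nnnorm_sum_le _ _).trans (Finset.sum_le_sum fun h _ => ?_)
            rw [nnnorm_mul]
            gcongr
            exact hM _
      _ = M ^ 2 * (∑ h ∈ F, ‖ψ (𝒢.mul (𝒢.inv h) g)‖₊) ^ 2 := by
            rw [← Finset.mul_sum, mul_pow]
      _ ≤ M ^ 2 * (F.card * ∑ h ∈ F, ‖ψ (𝒢.mul (𝒢.inv h) g)‖₊ ^ 2) := by
            gcongr
            exact sq_sum_le_card_mul_sum_sq
      _ ≤ M ^ 2 * (n * ∑ h ∈ F, ‖ψ (𝒢.mul (𝒢.inv h) g)‖₊ ^ 2) := by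
            gcongr
      _ = _ := by ring
  calc ‖𝒢.conv f ψ g‖ₑ ^ 2 = ((‖𝒢.conv f ψ g‖₊ ^ 2 : ℝ≥0) : ℝ≥0∞) := by
          simp [enorm_eq_nnnorm]
    _ ≤ ((n * M ^ 2 * ∑ h ∈ F, ‖ψ (𝒢.mul (𝒢.inv h) g)‖₊ ^ 2 : ℝ≥0) : ℝ≥0∞) := by
          exact_mod_cast hreal
    _ = n * M ^ 2 * ∑ h ∈ F, ‖ψ (𝒢.mul (𝒢.inv h) g)‖ₑ ^ 2 := by
          push_cast
          simp [enorm_eq_nnnorm]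
    _ = n * M ^ 2 * ∑ h ∈ F, K.indicator (fun h => ‖ψ (𝒢.mul (𝒢.inv h) g)‖ₑ ^ 2) (h : G) := by
          congr 1
          refine Finset.sum_congr rfl fun h hh => ?_
          rw [Set.indicator_of_mem (hFK h hh)]
    _ ≤ _ := by
          gcongr
          exact ENNReal.sum_le_tsum F

/-- Convolution by a bounded function with compact support is bounded on `ℓ²(G)`. -/
theorem tsum_conv_sq_le {f : G → ℂ} {K : Set G} (hK : IsCompact K) (hf : ∀ h, h ∉ K → f h = 0)
    {M : ℝ≥0} (hM : ∀ h, ‖f h‖₊ ≤ M) {n n' : ℕ}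
    (hn : ∀ x, {h | h ∈ K ∧ 𝒢.r h = x}.Finite ∧ {h | h ∈ K ∧ 𝒢.r h = x}.ncard ≤ n)
    (hn' : ∀ x, {h | h ∈ K ∧ 𝒢.s h = x}.Finite ∧ {h | h ∈ K ∧ 𝒢.s h = x}.ncard ≤ n')
    (ψ : G → ℂ) :
    ∑' g, ‖𝒢.conv f ψ g‖ₑ ^ 2 ≤ n * M ^ 2 * n' * ∑' k, ‖ψ k‖ₑ ^ 2 := by
  let j : (Σ g : G, {h : G // 𝒢.r h = 𝒢.r g}) → (Σ k : G, {h : G // 𝒢.s h = 𝒢.r k}) :=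
    fun p => ⟨𝒢.mul (𝒢.inv p.2) p.1, p.2, by
      rw [𝒢.r_mul _ _ ((𝒢.s_inv _).trans p.2.2), 𝒢.r_inv]⟩
  have hj : Function.Injective j := by
    have hl : Function.LeftInverse (fun q : (Σ k : G, {h : G // 𝒢.s h = 𝒢.r k}) =>
        (⟨𝒢.mul q.2 q.1, q.2, (𝒢.r_mul _ _ q.2.2).symm⟩ :
          (Σ g : G, {h : G // 𝒢.r h = 𝒢.r g}))) j := by
      rintro ⟨g, h, e⟩
      have := 𝒢.mul_inv_cancel_left h g e
      simp only [j]
      congr! 1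
      congr!
    exact hl.injective
  calc ∑' g, ‖𝒢.conv f ψ g‖ₑ ^ 2
      ≤ ∑' g, n * M ^ 2 * ∑' h : {h : G // 𝒢.r h = 𝒢.r g},
          K.indicator (fun h => ‖ψ (𝒢.mul (𝒢.inv h) g)‖ₑ ^ 2) (h : G) :=
        ENNReal.tsum_le_tsum fun g => 𝒢.enorm_conv_sq_le hK hf hM hn ψ g
    _ = n * M ^ 2 * ∑' p : (Σ g : G, {h : G // 𝒢.r h = 𝒢.r g}),
          (fun q : (Σ k : G, {h : G // 𝒢.s h = 𝒢.r k}) =>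
            K.indicator (fun _ => ‖ψ q.1‖ₑ ^ 2) (q.2 : G)) (j p) := by
        rw [ENNReal.tsum_mul_left, ENNReal.tsum_sigma']
        rfl
    _ ≤ n * M ^ 2 * ∑' q : (Σ k : G, {h : G // 𝒢.s h = 𝒢.r k}),
            K.indicator (fun _ => ‖ψ q.1‖ₑ ^ 2) (q.2 : G) := by
        gcongr
        exact ENNReal.tsum_comp_le_tsum_of_injective hj _
    _ ≤ n * M ^ 2 * ∑' k, n' * ‖ψ k‖ₑ ^ 2 := by
        rw [ENNReal.tsum_sigma']
        gcongr with k
        exact tsum_indicator_le (hn' _) _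
    _ = _ := by rw [ENNReal.tsum_mul_left, _root_.mul_assoc (n * M ^ 2 : ℝ≥0∞)]

/-- The operator of convolution by a bounded function which vanishes outside a compact set. -/
theorem exists_convOp {K : Set G} (hK : IsCompact K) :
    ∃ C : ℝ, 0 ≤ C ∧ ∀ f : G → ℂ, (∀ h, h ∉ K → f h = 0) → ∀ M : ℝ, 0 ≤ M → (∀ h, ‖f h‖ ≤ M) →
      ∃ T : L2 G →L[ℂ] L2 G, (∀ ψ g, T ψ g = 𝒢.conv f ψ g) ∧ ‖T‖ ≤ C * M := by
  obtain ⟨n, hn⟩ := exists_fiber_bound 𝒢.isLocalHomeomorph_r hK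
  obtain ⟨n', hn'⟩ := exists_fiber_bound 𝒢.isLocalHomeomorph_s hK
  refine ⟨Real.sqrt (n * n'), Real.sqrt_nonneg _, fun f hf M hM0 hM => ?_⟩
  lift M to ℝ≥0 using hM0
  have hM' : ∀ h, ‖f h‖₊ ≤ M := fun h => by exact_mod_cast hM h
  have h2 : (0 : ℝ) < (2 : ℝ≥0∞).toReal := by norm_num
  have hsq : ∀ ψ : L2 G, (∑' k, ‖ψ k‖ₑ ^ 2) = ENNReal.ofReal (‖ψ‖ ^ 2) := by
    intro ψ
    have h1 := lp.hasSum_norm h2 ψ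
    simp only [ENNReal.toReal_ofNat, Real.rpow_ofNat] at h1
    rw [← h1.tsum_eq, ENNReal.ofReal_tsum_of_nonneg (fun _ => by positivity) h1.summable]
    refine tsum_congr fun k => ?_
    rw [ENNReal.ofReal_pow (norm_nonneg _), ofReal_norm]
  have hb : ∀ ψ : L2 G, (∑' g, ‖𝒢.conv f ψ g‖ₑ ^ 2)
      ≤ ENNReal.ofReal ((n * n') * (M : ℝ) ^ 2 * ‖ψ‖ ^ 2) := by
    intro ψ
    refine (𝒢.tsum_conv_sq_le hK hf hM' hn hn' ψ).trans (le_of_eq ?_)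
    rw [hsq ψ, ENNReal.ofReal_mul (by positivity), ENNReal.ofReal_mul (by positivity),
      ENNReal.ofReal_mul (by positivity), ENNReal.ofReal_pow (by positivity)]
    simp
    ring
  have hsum : ∀ ψ : L2 G, Summable fun g => ‖𝒢.conv f ψ g‖ ^ 2 := by
    intro ψ
    have : (∑' g, ENNReal.ofReal (‖𝒢.conv f ψ g‖ ^ 2)) ≠ ∞ := by
      refine ne_top_of_le_ne_top ENNReal.ofReal_ne_top (le_trans (le_of_eq ?_) (hb ψ))
      refine tsum_congr fun k => ?_
      rw [ENNReal.ofReal_pow (norm_nonneg _), ofReal_norm]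
    have := ENNReal.summable_toReal this
    refine this.congr fun g => ?_
    rw [ENNReal.toReal_ofReal (by positivity)]
  have hmem : ∀ ψ : L2 G, Memℓp (𝒢.conv f ψ) 2 := by
    intro ψ
    refine memℓp_gen ?_
    simpa using hsum ψ
  let T : L2 G →ₗ[ℂ] L2 G :=
    { toFun := fun ψ => ⟨𝒢.conv f ψ, hmem ψ⟩
      map_add' := by
        intro ψ φ
        ext g
        simp only [conv, lp.coeFn_add, Pi.add_apply, mul_add]
        exact (summable_of_hasFiniteSupport (𝒢.summable_conv hK hf ψ g)).tsum_add
          (summable_of_hasFiniteSupport (𝒢.summable_conv hK hf φ g))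
      map_smul' := by
        intro c ψ
        ext g
        simp only [conv, lp.coeFn_smul, Pi.smul_apply, smul_eq_mul, RingHom.id_apply,
          ← tsum_mul_left]
        exact tsum_congr fun h => by ring }
  have hT : ∀ ψ, ‖T ψ‖ ≤ Real.sqrt (n * n') * M * ‖ψ‖ := by
    intro ψ
    refine (sq_le_sq₀ (norm_nonneg _) (by positivity)).1 ?_
    rw [mul_pow, mul_pow, Real.sq_sqrt (by positivity),
      ← ENNReal.ofReal_le_ofReal_iff (by positivity), ← hsq]
    exact hb ψ
  exact ⟨T.mkContinuous _ hT, fun _ _ => rfl, T.mkContinuous_norm_le (by positivity) hT⟩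

theorem exists_regRep (f : C_c(G, ℂ)) :
    ∃ T : L2 G →L[ℂ] L2 G, ∀ ψ g, T ψ g = 𝒢.conv f ψ g := by
  obtain ⟨C, -, hC⟩ := 𝒢.exists_convOp f.hasCompactSupport.isCompact
  obtain ⟨M, hM⟩ := f.hasCompactSupport.exists_bound_of_continuous f.continuous
  obtain ⟨T, hT, -⟩ := hC f (fun h hh => image_eq_zero_of_notMem_tsupport hh) (max M 0)
    (le_max_right _ _) (fun h => (hM h).trans (le_max_left _ _))
  exact ⟨T, hT⟩

theorem regRep_aux_ext {G : Type*} {S T : L2 G →L[ℂ] L2 G} (h : ∀ ψ g, S ψ g = T ψ g) : S = T := by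
  ext ψ g
  exact h ψ g

/-- The representation `π` of `C_c(G)` on `ℓ²(G)`,
`(π(f)ψ)(g) = ∑_{h ∈ G^{r(g)}} f(h) ψ(h⁻¹ g)`, which is the direct sum of the representations `π_x`
on `ℓ²(G_x)`, `x ∈ X`. In particular `‖π(f)‖ = sup_x ‖π_x(f)‖`. -/
noncomputable def regRep : C_c(G, ℂ) →ₗ[ℂ] (L2 G →L[ℂ] L2 G) where
  toFun f := (𝒢.exists_regRep f).choose
  map_add' f₁ f₂ := by
    refine regRep_aux_ext fun ψ g => ?_
    rw [(𝒢.exists_regRep (f₁ + f₂)).choose_spec, _root_.add_apply, lp.coeFn_add,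
      Pi.add_apply, (𝒢.exists_regRep f₁).choose_spec, (𝒢.exists_regRep f₂).choose_spec]
    have h1 : ∀ f : C_c(G, ℂ), Summable fun h : {h : G // 𝒢.r h = 𝒢.r g} =>
        f h * ψ (𝒢.mul (𝒢.inv h) g) := fun f => summable_of_hasFiniteSupport
      (𝒢.summable_conv f.hasCompactSupport.isCompact
        (fun h hh => image_eq_zero_of_notMem_tsupport hh) ψ g)
    simp only [conv, CompactlySupportedContinuousMap.coe_add, Pi.add_apply, add_mul]
    exact (h1 f₁).tsum_add (h1 f₂)
  map_smul' c f := by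
    refine regRep_aux_ext fun ψ g => ?_
    rw [(𝒢.exists_regRep (c • f)).choose_spec, RingHom.id_apply, _root_.smul_apply,
      lp.coeFn_smul, Pi.smul_apply, (𝒢.exists_regRep f).choose_spec]
    simp only [conv, CompactlySupportedContinuousMap.coe_smul, Pi.smul_apply, smul_eq_mul,
      ← tsum_mul_left, _root_.mul_assoc]

theorem regRep_apply (f : C_c(G, ℂ)) (ψ : L2 G) (g : G) :
    𝒢.regRep f ψ g = ∑' h : {h : G // 𝒢.r h = 𝒢.r g}, f h * ψ (𝒢.mul (𝒢.inv h) g) :=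
  (𝒢.exists_regRep f).choose_spec ψ g

theorem exists_norm_regRep_le {K : Set G} (hK : IsCompact K) :
    ∃ C : ℝ, 0 ≤ C ∧ ∀ f : C_c(G, ℂ), (∀ h, h ∉ K → f h = 0) → ∀ M : ℝ, 0 ≤ M →
      (∀ h, ‖f h‖ ≤ M) → ‖𝒢.regRep f‖ ≤ C * M := by
  obtain ⟨C, hC0, hC⟩ := 𝒢.exists_convOp hK
  refine ⟨C, hC0, fun f hf M hM0 hM => ?_⟩
  obtain ⟨T, hT, hTC⟩ := hC f hf M hM0 hM
  have : 𝒢.regRep f = T := regRep_aux_ext fun ψ g => by rw [hT, regRep_apply]; rfl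
  rwa [this]

/-- The reduced groupoid C*-algebra `C*_r(G)`: the completion of `C_c(G)` in the norm
`‖f‖_r = sup_x ‖π_x(f)‖ = ‖π(f)‖`, realized as the norm closure of the *-algebra generated by
`π(C_c(G))` on `ℓ²(G)`. (For Hausdorff `G`, `π(C_c(G))` is itself a *-algebra: the product
`π(f) π(g)` is `π` of the convolution product of `f` and `g`, and `π(f)* = π(f*)` with
`f*(g) = conj (f (g⁻¹))`.) -/
noncomputable def reducedSubalgebra : NonUnitalStarSubalgebra ℂ (L2 G →L[ℂ] L2 G) :=
  (NonUnitalStarAlgebra.adjoin ℂ (Set.range 𝒢.regRep)).topologicalClosure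

/-- `C*_r(G)` as a C*-algebra. -/
abbrev CstarR : Type _ := 𝒢.reducedSubalgebra

noncomputable instance : NonUnitalCStarAlgebra 𝒢.CstarR :=
  NonUnitalStarSubalgebra.nonUnitalCStarAlgebra 𝒢.reducedSubalgebra
    (h_closed := NonUnitalStarSubalgebra.isClosed_topologicalClosure _)

/-- The inclusion `C_c(G) ⊆ C*_r(G)`; products of elements of `C_c(G)` are taken in `C*_r(G)`. -/
noncomputable def toCstarR : C_c(G, ℂ) →ₗ[ℂ] 𝒢.CstarR where
  toFun f := ⟨𝒢.regRep f, NonUnitalStarSubalgebra.le_topologicalClosure _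
    (NonUnitalStarAlgebra.subset_adjoin ℂ _ ⟨f, rfl⟩)⟩
  map_add' f₁ f₂ := Subtype.ext (map_add 𝒢.regRep f₁ f₂)
  map_smul' c f := Subtype.ext (map_smul 𝒢.regRep c f)

/-- A closed *-subalgebra of operators that contains `π(C_c(G))` contains `C*_r(G)`. -/
theorem reducedSubalgebra_le {S : NonUnitalStarSubalgebra ℂ (L2 G →L[ℂ] L2 G)}
    (hS : IsClosed (S : Set (L2 G →L[ℂ] L2 G))) (h : ∀ f, 𝒢.regRep f ∈ S) :
    𝒢.reducedSubalgebra ≤ S :=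
  NonUnitalStarSubalgebra.topologicalClosure_minimal _
    (NonUnitalStarAlgebra.adjoin_le (by rintro _ ⟨f, rfl⟩; exact h f)) hS

/-! ### The conditional expectation and the weight of a measure -/

open Classical in
/-- The point mass at `g` as an element of `ℓ²(G)`. -/
noncomputable def delta (g : G) : L2 G := lp.single 2 g (1 : ℂ)

/-- The conditional expectation `P : C*_r(G) → C₀(X)`: the continuous extension of the restriction
map `C_c(G) → C_c(X)`, given by the diagonal coefficients `P(a)(x) = ⟨δ_x, a δ_x⟩`. See
`condExp_toCstarR` and `norm_condExp_le`. -/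
noncomputable def condExp : 𝒢.CstarR →ₗ[ℂ] (X → ℂ) where
  toFun a x := ((a : L2 G →L[ℂ] L2 G) (delta (𝒢.unit x))) (𝒢.unit x)
  map_add' a b := by ext x; simp
  map_smul' c a := by ext x; simp

theorem condExp_toCstarR (f : C_c(G, ℂ)) (x : X) :
    𝒢.condExp (𝒢.toCstarR f) x = f (𝒢.unit x) := by
  classical
  change 𝒢.regRep f (delta (𝒢.unit x)) (𝒢.unit x) = _
  rw [regRep_apply, tsum_eq_single ⟨𝒢.unit x, rfl⟩]
  · have h1 : 𝒢.mul (𝒢.inv (𝒢.unit x)) (𝒢.unit x) = 𝒢.unit x := by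
      rw [𝒢.inv_mul, 𝒢.s_unit]
    simp [h1, delta]
  · rintro ⟨h, hr⟩ hne
    have h1 : 𝒢.mul (𝒢.inv h) (𝒢.unit x) ≠ 𝒢.unit x := by
      intro he
      apply hne
      have h2 := 𝒢.mul_inv_cancel_left h (𝒢.unit x) hr
      have h3 : 𝒢.s h = x := by
        have := congrArg 𝒢.r he
        rwa [𝒢.r_mul _ _ ((𝒢.s_inv h).trans hr), 𝒢.r_inv, 𝒢.r_unit] at this
      rw [he] at h2
      have h4 := 𝒢.mul_unit h
      rw [h3, h2] at h4
      exact Subtype.ext h4.symm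
    simp [delta, h1]

theorem norm_condExp_le (a : 𝒢.CstarR) (x : X) : ‖𝒢.condExp a x‖ ≤ ‖a‖ := by
  classical
  have h1 : ‖delta (𝒢.unit x)‖ = 1 := by simp [delta]
  calc ‖𝒢.condExp a x‖ ≤ ‖(a : L2 G →L[ℂ] L2 G) (delta (𝒢.unit x))‖ :=
        lp.norm_apply_le_norm (by simp) _ _
    _ ≤ ‖(a : L2 G →L[ℂ] L2 G)‖ * ‖delta (𝒢.unit x)‖ := ContinuousLinearMap.le_opNorm _ _
    _ = ‖a‖ := by rw [h1, mul_one]; rfl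

/-- The weight `φ_m(a) = ∫ P(a) dm`, `a ∈ C*_r(G)₊`, of a measure `m` on the unit space. -/
noncomputable def weight [MeasurableSpace X] (m : Measure X) (a : 𝒢.CstarR) : ℝ≥0∞ :=
  ∫⁻ x, ENNReal.ofReal (𝒢.condExp a x).re ∂m

/-! ### The one-parameter group of a continuous homomorphism -/

/-- A continuous homomorphism `c : G → ℝ`. -/
structure ContHom where
  toFun : G → ℝ
  continuous_toFun : Continuous toFun
  map_mul : ∀ g h, 𝒢.s g = 𝒢.r h → toFun (𝒢.mul g h) = toFun g + toFun h

namespace ContHom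

variable {𝒢} (c : 𝒢.ContHom)

/-- `σ_z(f)(g) = e^{i z c(g)} f(g)` for `f ∈ C_c(G)` and `z ∈ ℂ`. -/
noncomputable def twist (z : ℂ) (f : C_c(G, ℂ)) : C_c(G, ℂ) where
  toFun g := Complex.exp (Complex.I * z * c.toFun g) * f g
  continuous_toFun := by
    have := c.continuous_toFun
    have := f.continuous
    fun_prop
  hasCompactSupport' := f.hasCompactSupport.mul_left

theorem twist_apply (z : ℂ) (f : C_c(G, ℂ)) (g : G) :
    c.twist z f g = Complex.exp (Complex.I * z * c.toFun g) * f g := rfl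

theorem norm_phase (t : ℝ) (g : G) : ‖Complex.exp (Complex.I * t * c.toFun g)‖ = 1 := by
  have : Complex.I * t * c.toFun g = ((t * c.toFun g : ℝ) : ℂ) * Complex.I := by push_cast; ring
  rw [this, Complex.norm_exp_ofReal_mul_I]

theorem map_inv_mul (h g : G) (e : 𝒢.r h = 𝒢.r g) :
    c.toFun (𝒢.mul (𝒢.inv h) g) = c.toFun g - c.toFun h := by
  have h1 := c.map_mul h (𝒢.mul (𝒢.inv h) g)
    (by rw [𝒢.r_mul _ _ ((𝒢.s_inv h).trans e), 𝒢.r_inv])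
  rw [𝒢.mul_inv_cancel_left h g e] at h1
  linarith

/-- The operator of multiplication by `e^{i t c}` on `ℓ²(G)`. -/
noncomputable def phaseLin (t : ℝ) : L2 G →ₗᵢ[ℂ] L2 G where
  toFun ψ := ⟨fun g => Complex.exp (Complex.I * t * c.toFun g) * ψ g,
    (lp.memℓp ψ).mono' fun g => by rw [norm_mul, norm_phase, one_mul]⟩
  map_add' ψ φ := by
    ext g
    simp only [lp.coeFn_add, Pi.add_apply, mul_add]
  map_smul' a ψ := by ext g; simp; ring
  norm_map' ψ := by
    have h2 : (0 : ℝ) < (2 : ℝ≥0∞).toReal := by norm_num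
    rw [lp.norm_eq_tsum_rpow h2, lp.norm_eq_tsum_rpow h2]
    congr 1
    refine tsum_congr fun g => ?_
    congr 1
    exact (norm_mul _ _).trans (by rw [norm_phase, one_mul])

theorem phaseLin_apply (t : ℝ) (ψ : L2 G) (g : G) :
    c.phaseLin t ψ g = Complex.exp (Complex.I * t * c.toFun g) * ψ g := rfl

theorem phaseLin_add (s t : ℝ) (ψ : L2 G) :
    c.phaseLin (s + t) ψ = c.phaseLin s (c.phaseLin t ψ) := by
  ext g
  simp only [phaseLin_apply]
  rw [← _root_.mul_assoc, ← Complex.exp_add]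
  congr 2
  push_cast
  ring

theorem phaseLin_zero (ψ : L2 G) : c.phaseLin 0 ψ = ψ := by
  ext g
  simp [phaseLin_apply]

/-- The unitary `u_t` of multiplication by `e^{i t c}` on `ℓ²(G)`. -/
noncomputable def phase (t : ℝ) : unitary (L2 G →L[ℂ] L2 G) :=
  Unitary.linearIsometryEquiv.symm
    { c.phaseLin t with
      invFun := c.phaseLin (-t)
      left_inv := fun ψ => by
        change c.phaseLin (-t) (c.phaseLin t ψ) = ψ
        rw [← phaseLin_add, neg_add_cancel, phaseLin_zero]
      right_inv := fun ψ => by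
        change c.phaseLin t (c.phaseLin (-t) ψ) = ψ
        rw [← phaseLin_add, add_neg_cancel, phaseLin_zero] }

theorem phase_apply (t : ℝ) (ψ : L2 G) :
    (c.phase t : L2 G →L[ℂ] L2 G) ψ = c.phaseLin t ψ := rfl

theorem phase_add (s t : ℝ) : c.phase (s + t) = c.phase s * c.phase t := by
  apply Subtype.ext
  refine ContinuousLinearMap.ext fun ψ => ?_
  exact c.phaseLin_add s t ψ

theorem phase_zero : c.phase 0 = 1 := by
  apply Subtype.ext
  refine ContinuousLinearMap.ext fun ψ => ?_
  exact c.phaseLin_zero ψ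

theorem star_phase (t : ℝ) : star (c.phase t) = c.phase (-t) := by
  rw [Unitary.star_eq_inv, inv_eq_iff_mul_eq_one, ← phase_add, add_neg_cancel, phase_zero]

/-- The automorphism `T ↦ u_t T u_t*` of the bounded operators on `ℓ²(G)`. -/
noncomputable def conjAut (t : ℝ) : (L2 G →L[ℂ] L2 G) ≃⋆ₐ[ℂ] (L2 G →L[ℂ] L2 G) :=
  Unitary.conjStarAlgAut ℂ _ (c.phase t)

theorem conjAut_apply (t : ℝ) (T : L2 G →L[ℂ] L2 G) (ψ : L2 G) :
    c.conjAut t T ψ = c.phaseLin t (T (c.phaseLin (-t) ψ)) := by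
  have h : c.conjAut t T = (c.phase t : L2 G →L[ℂ] L2 G) * T *
      ((star (c.phase t) : unitary (L2 G →L[ℂ] L2 G)) : L2 G →L[ℂ] L2 G) := rfl
  rw [h, star_phase]
  rfl

theorem conjAut_add (s t : ℝ) (T : L2 G →L[ℂ] L2 G) :
    c.conjAut (s + t) T = c.conjAut s (c.conjAut t T) := by
  refine ContinuousLinearMap.ext fun ψ => ?_
  simp only [conjAut_apply]
  rw [phaseLin_add, neg_add_rev, phaseLin_add]

theorem conjAut_zero (T : L2 G →L[ℂ] L2 G) : c.conjAut 0 T = T := by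
  refine ContinuousLinearMap.ext fun ψ => ?_
  simp only [conjAut_apply, neg_zero, phaseLin_zero]

theorem norm_conjAut (t : ℝ) (T : L2 G →L[ℂ] L2 G) : ‖c.conjAut t T‖ = ‖T‖ := by
  have h : ∀ (t : ℝ) (T : L2 G →L[ℂ] L2 G), ‖c.conjAut t T‖ ≤ ‖T‖ := fun t T => by
    refine ContinuousLinearMap.opNorm_le_bound _ (norm_nonneg _) fun ψ => ?_
    rw [conjAut_apply, LinearIsometry.norm_map]
    refine (T.le_opNorm _).trans ?_
    rw [LinearIsometry.norm_map]
  refine le_antisymm (h t T) ?_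
  have := h (-t) (c.conjAut t T)
  rwa [← conjAut_add, neg_add_cancel, conjAut_zero] at this

theorem conjAut_regRep (t : ℝ) (f : C_c(G, ℂ)) :
    c.conjAut t (𝒢.regRep f) = 𝒢.regRep (c.twist t f) := by
  refine regRep_aux_ext fun ψ g => ?_
  rw [conjAut_apply, phaseLin_apply, regRep_apply, regRep_apply, ← tsum_mul_left]
  refine tsum_congr fun h => ?_
  rw [phaseLin_apply, twist_apply, c.map_inv_mul h g h.2]
  have : Complex.exp (Complex.I * t * c.toFun g) *
      Complex.exp (Complex.I * (-t : ℝ) * (c.toFun g - c.toFun h : ℝ))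
      = Complex.exp (Complex.I * t * c.toFun h) := by
    rw [← Complex.exp_add]
    congr 1
    push_cast
    ring
  rw [← this]
  ring

theorem conjAut_mem (t : ℝ) {T : L2 G →L[ℂ] L2 G} (hT : T ∈ 𝒢.reducedSubalgebra) :
    c.conjAut t T ∈ 𝒢.reducedSubalgebra := by
  have hc : Continuous (c.conjAut t) := by
    refine (AddMonoidHomClass.isometry_of_norm (c.conjAut t) (c.norm_conjAut t)).continuous
  have := 𝒢.reducedSubalgebra_le
    (S := NonUnitalStarSubalgebra.comap (c.conjAut t) 𝒢.reducedSubalgebra)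
    ((NonUnitalStarSubalgebra.isClosed_topologicalClosure _).preimage hc)
    (fun f => by
      rw [NonUnitalStarSubalgebra.mem_comap, conjAut_regRep]
      exact (𝒢.toCstarR (c.twist t f)).2)
  exact this hT

/-- The automorphism `σ_t` of `C*_r(G)`, the continuous extension of `f ↦ e^{i t c} f`. -/
noncomputable def sigmaAut (t : ℝ) : 𝒢.CstarR ≃⋆ₐ[ℂ] 𝒢.CstarR where
  toFun a := ⟨c.conjAut t a, c.conjAut_mem t a.2⟩
  invFun a := ⟨c.conjAut (-t) a, c.conjAut_mem (-t) a.2⟩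
  left_inv a := Subtype.ext (by simp only [← conjAut_add, neg_add_cancel, conjAut_zero])
  right_inv a := Subtype.ext (by simp only [← conjAut_add, add_neg_cancel, conjAut_zero])
  map_mul' a b := Subtype.ext (_root_.map_mul (c.conjAut t) (a : L2 G →L[ℂ] L2 G) b)
  map_add' a b := Subtype.ext (map_add (c.conjAut t) (a : L2 G →L[ℂ] L2 G) b)
  map_star' a := Subtype.ext (map_star (c.conjAut t) (a : L2 G →L[ℂ] L2 G))
  map_smul' z a := Subtype.ext (map_smul (c.conjAut t) z (a : L2 G →L[ℂ] L2 G))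

theorem sigmaAut_toCstarR (t : ℝ) (f : C_c(G, ℂ)) :
    c.sigmaAut t (𝒢.toCstarR f) = 𝒢.toCstarR (c.twist t f) :=
  Subtype.ext (c.conjAut_regRep t f)

/-- `z ↦ σ_z(f)` is entire for `f ∈ C_c(G)`: the elements of `C_c(G)` are analytic for `σ` and
`σ_z(f)` is the analytic continuation of `t ↦ σ_t(f)`. -/
theorem differentiable_twist (f : C_c(G, ℂ)) :
    Differentiable ℂ fun z => 𝒢.regRep (c.twist z f) := by
  intro z
  obtain ⟨C, hC0, hC⟩ := 𝒢.exists_norm_regRep_le f.hasCompactSupport.isCompact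
  obtain ⟨M, hM⟩ := (c.twist z f).hasCompactSupport.exists_bound_of_continuous
    (c.twist z f).continuous
  obtain ⟨R, hR⟩ := f.hasCompactSupport.isCompact.exists_bound_of_continuousOn
    c.continuous_toFun.continuousOn
  have hM0 : 0 ≤ max M 0 := le_max_right _ _
  set R' := max R 1 with hR'
  have hR0 : 0 < R' := lt_of_lt_of_le one_pos (le_max_right _ _)
  let D : C_c(G, ℂ) :=
    { toFun := fun g => Complex.I * c.toFun g * c.twist z f g
      continuous_toFun := by
        have := c.continuous_toFun
        have := (c.twist z f).continuous
        fun_prop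
      hasCompactSupport' := (c.twist z f).hasCompactSupport.mul_left }
  have hD : ∀ g, D g = Complex.I * c.toFun g * c.twist z f g := fun _ => rfl
  refine HasDerivAt.differentiableAt (f' := 𝒢.regRep D) ?_
  rw [hasDerivAt_iff_isLittleO]
  have hO : (fun z' => 𝒢.regRep (c.twist z' f) - 𝒢.regRep (c.twist z f) - (z' - z) • 𝒢.regRep D)
      =O[𝓝 z] fun z' => (z' - z) ^ 2 := by
    refine Asymptotics.IsBigO.of_bound (C * (R' ^ 2 * max M 0)) ?_
    have hball : ∀ᶠ z' in 𝓝 z, ‖z' - z‖ < 1 / R' := by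
      have := Metric.ball_mem_nhds z (show (0 : ℝ) < 1 / R' by positivity)
      filter_upwards [this] with z' hz'
      simpa [dist_eq_norm] using hz'
    filter_upwards [hball] with z' hz'
    have e : 𝒢.regRep (c.twist z' f) - 𝒢.regRep (c.twist z f) - (z' - z) • 𝒢.regRep D
        = 𝒢.regRep (c.twist z' f - c.twist z f - (z' - z) • D) := by
      rw [map_sub, map_sub, map_smul]
    rw [e, norm_pow]
    have h0 : ∀ h, h ∉ tsupport f → f h = 0 := fun h hh => image_eq_zero_of_notMem_tsupport hh
    have := hC (c.twist z' f - c.twist z f - (z' - z) • D) (fun h hh => by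
      simp [hD, twist_apply, h0 h hh]) (R' ^ 2 * max M 0 * ‖z' - z‖ ^ 2) (by positivity) ?_
    · refine this.trans (le_of_eq (by ring))
    intro h
    by_cases hh : h ∈ tsupport f
    · have hc : ‖(c.toFun h : ℂ)‖ ≤ R' := by
        rw [Complex.norm_real]; exact (hR h hh).trans (le_max_left _ _)
      set w : ℂ := Complex.I * (z' - z) * c.toFun h with hw
      have hwn : ‖w‖ ≤ ‖z' - z‖ * R' := by
        rw [hw, norm_mul, norm_mul, Complex.norm_I, one_mul]
        gcongr
      have hw1 : ‖w‖ ≤ 1 := hwn.trans (by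
        have := mul_le_mul_of_nonneg_right hz'.le hR0.le
        rwa [one_div, inv_mul_cancel₀ hR0.ne'] at this)
      have e2 : (c.twist z' f - c.twist z f - (z' - z) • D) h
          = (Complex.exp w - 1 - w) * c.twist z f h := by
        have : c.twist z' f h = Complex.exp w * c.twist z f h := by
          rw [twist_apply, twist_apply, ← _root_.mul_assoc, ← Complex.exp_add]
          congr 2
          rw [hw]; ring
        simp only [CompactlySupportedContinuousMap.coe_sub, Pi.sub_apply, this,
          CompactlySupportedContinuousMap.coe_smul, Pi.smul_apply, smul_eq_mul, hD, hw]
        ring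
      rw [e2, norm_mul]
      calc ‖Complex.exp w - 1 - w‖ * ‖c.twist z f h‖ ≤ ‖w‖ ^ 2 * max M 0 := by
            gcongr
            · exact Complex.norm_exp_sub_one_sub_id_le hw1
            · exact (hM h).trans (le_max_left _ _)
        _ ≤ (‖z' - z‖ * R') ^ 2 * max M 0 := by gcongr
        _ = _ := by ring
    · have : (c.twist z' f - c.twist z f - (z' - z) • D) h = 0 := by
        simp [hD, twist_apply, h0 h hh]
      rw [this, norm_zero]
      positivity
  refine hO.trans_isLittleO ?_
  have h1 : (fun z' : ℂ => z' - z) =o[𝓝 z] fun _ => (1 : ℂ) := by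
    rw [Asymptotics.isLittleO_one_iff]
    have : Continuous fun z' : ℂ => z' - z := by fun_prop
    simpa using this.tendsto z
  have := h1.mul_isBigO (Asymptotics.isBigO_refl (fun z' : ℂ => z' - z) (𝓝 z))
  simpa [sq] using this

/-- The one-parameter group `σ^c` of automorphisms of `C*_r(G)`. -/
noncomputable def sigma : CStarWeight.OneParamGroup 𝒢.CstarR where
  aut := c.sigmaAut
  aut_zero a := Subtype.ext (c.conjAut_zero _)
  aut_add s t a := Subtype.ext (c.conjAut_add s t _)
  continuous_aut a := by
    let S : NonUnitalStarSubalgebra ℂ (L2 G →L[ℂ] L2 G) :=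
      { carrier := {T | Continuous fun t : ℝ => c.conjAut t T}
        add_mem' := fun {a b} ha hb => by
          simp only [Set.mem_ofPred_eq, map_add] at *
          exact ha.add hb
        zero_mem' := by simp only [Set.mem_ofPred_eq, map_zero]; exact continuous_const
        mul_mem' := fun {a b} ha hb => by
          simp only [Set.mem_ofPred_eq, _root_.map_mul] at *
          exact ha.mul hb
        smul_mem' := fun z a ha => by
          simp only [Set.mem_ofPred_eq, map_smul] at *
          exact ha.const_smul z
        star_mem' := fun {a} ha => by
          simp only [Set.mem_ofPred_eq, map_star] at *
          exact ha.star }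
    have hS : IsClosed (S : Set (L2 G →L[ℂ] L2 G)) := by
      refine isClosed_of_closure_subset fun T hT => ?_
      change Continuous fun t : ℝ => c.conjAut t T
      refine continuous_of_uniform_approx_of_continuous fun u hu => ?_
      obtain ⟨ε, hε, hεu⟩ := Metric.mem_uniformity_dist.1 hu
      obtain ⟨T', hT', hd⟩ := Metric.mem_closure_iff.1 hT ε hε
      refine ⟨fun t => c.conjAut t T', hT', fun t => hεu ?_⟩
      rw [dist_eq_norm, ← map_sub, norm_conjAut, ← dist_eq_norm]
      exact hd
    have hle := 𝒢.reducedSubalgebra_le hS (fun f => by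
      change Continuous fun t : ℝ => c.conjAut t (𝒢.regRep f)
      simp only [conjAut_regRep]
      exact (c.differentiable_twist f).continuous.comp Complex.continuous_ofReal)
    exact Continuous.subtype_mk (hle a.2) _

end ContHom

/-! ### Conformal measures -/

/-- An open bisection: an open subset of `G` on which `r` and `s` are injective (since `r` and `s`
are local homeomorphisms, they restrict to homeomorphisms onto open subsets of `X`). -/
structure IsOpenBisection (W : Set G) : Prop where
  isOpen : IsOpen W
  injOn_r : Set.InjOn 𝒢.r W
  injOn_s : Set.InjOn 𝒢.s W

/-- The inverse `r_W⁻¹ : r(W) → W` of `r : W → r(W)`. -/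
noncomputable def IsOpenBisection.rInv {𝒢 : EtaleGroupoid G X} {W : Set G}
    (hW : 𝒢.IsOpenBisection W) : 𝒢.r '' W → W :=
  (Equiv.Set.imageOfInjOn 𝒢.r W hW.injOn_r).symm

/-- `m` is `(G, c)`-conformal with exponent `β`:
`m(s(W)) = ∫_{r(W)} e^{β c(r_W⁻¹(x))} dm(x)` for every open bisection `W`. -/
def IsConformal {𝒢 : EtaleGroupoid G X} [MeasurableSpace X] (c : 𝒢.ContHom) (β : ℝ)
    (m : Measure X) : Prop :=
  ∀ (W : Set G) (hW : 𝒢.IsOpenBisection W),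
    m (𝒢.s '' W) = ∫⁻ x : 𝒢.r '' W,
      ENNReal.ofReal (Real.exp (β * c.toFun (hW.rInv x))) ∂(m.comap Subtype.val)

end EtaleGroupoid

/-! ### Measures obtained by counting along the fibres of a local homeomorphism -/

section FiberMeasure

variable {G X : Type*} [TopologicalSpace G] [TopologicalSpace X]

/-! Everything reduces to two measures on `G`: `sMeasure`, written μ_s, integrates the counting
measures on the fibres of `s` against `m`, and `rMeasure`, written μ_r, does the same for `r`.
Inversion interchanges them. All three conditions turn out to express μ_r = e^{-βc} μ_s.

Conformality is the equality μ_s = e^{βc} μ_r on open bisections. These are closed under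
intersection, generate the Borel sets and include a countable cover by sets of finite measure, so
the equality holds everywhere (`isConformal_iff_sMeasure_eq`). Inverting the density gives the form
above.

On the algebra side, an element `a` of C*_r(G) is a continuous function on `G` (`coeff`), and
P(a*b)(x) is the sum of conj(a(g)) b(g) over s(g) = x. Hence 𝒩 consists of the elements whose
function lies in L²(μ_s), and φ_m(ab) = ∫ a(g⁻¹) b(g) dμ_s(g) (`ext_weight_mul`). For f, g in
C_c(G), the identity in condition 2 becomes ∫ f(h) g(h⁻¹) dμ_r = ∫ e^{-βc(h)} f(h) g(h⁻¹) dμ_s. Such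
products include every compactly supported function, so condition 2 is equivalent to the equality of
measures (`rMeasure_eq_iff_ext_weight`).

For 1 → 3 the KMS function is explicit: F(z) = ∫ e^{izc(g)} a(g⁻¹) b(g) dμ_s(g). On the strip its
integrand is dominated using |e^{izc}| ≤ 1 + e^{-βc}, and the equality of measures supplies
integrability for both terms as well as the value on the upper edge (`isKMSWeight_weight`). For 3 →
2, the KMS function of a pair from C_c(G) and z ↦ φ_m(g σ_z(f)) are bounded, holomorphic inside the
strip and equal on ℝ. The three lines theorem makes them equal at iβ
(`eq_zero_of_forall_real_eq_zero`). -/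

theorem IsLocalHomeomorph.isOpenEmbedding_restrict_of_injOn {p : G → X}
    (hp : IsLocalHomeomorph p) {U : Set G} (hU : IsOpen U) (hi : InjOn p U) :
    IsOpenEmbedding (fun u : U => p u) :=
  (hp.comp hU.isOpenEmbedding_subtypeVal.isLocalHomeomorph).isOpenEmbedding_of_injective
    fun a b h => Subtype.ext (hi a.2 b.2 h)

theorem IsLocalHomeomorph.exists_countable_cover [SecondCountableTopology G] {p : G → X}
    (hp : IsLocalHomeomorph p) :
    ∃ U : ℕ → Set G, (∀ n, IsOpen (U n)) ∧ (∀ n, InjOn p (U n)) ∧ ⋃ n, U n = univ := by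
  choose e he hpe using hp
  rcases isEmpty_or_nonempty G with hG | hG
  · exact ⟨fun _ => ∅, fun _ => isOpen_empty, fun _ => injOn_empty _, Subsingleton.elim _ _⟩
  obtain ⟨t, ht, hU⟩ := TopologicalSpace.countable_cover_nhds
    (fun g => (e g).open_source.mem_nhds (he g))
  have htne : t.Nonempty := by
    rw [nonempty_iff_ne_empty]
    rintro rfl
    simp only [mem_empty_iff_false, iUnion_of_empty, iUnion_empty] at hU
    exact empty_ne_univ hU
  obtain ⟨u, hu⟩ := ht.exists_eq_range htne
  refine ⟨fun n => (e (u n)).source, fun n => (e _).open_source, fun n => ?_, ?_⟩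
  · have := (e (u n)).injOn
    rwa [← hpe] at this
  · rw [← hU, hu, biUnion_range]

theorem IsLocalHomeomorph.countable_fiber [SecondCountableTopology G] {p : G → X}
    (hp : IsLocalHomeomorph p) (x : X) :
    (p ⁻¹' {x}).Countable := by
  obtain ⟨U, -, hUi, hU⟩ := hp.exists_countable_cover
  have e : p ⁻¹' {x} = ⋃ n, p ⁻¹' {x} ∩ U n := by rw [← inter_iUnion, hU, inter_univ]
  rw [e]
  refine countable_iUnion fun n => Set.Subsingleton.countable ?_
  rintro a ⟨ha, ha'⟩ b ⟨hb, hb'⟩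
  exact hUi n ha' hb' ((ha : p a = x).trans (hb : p b = x).symm)

theorem count_fiber_inter {G X : Type*} [MeasurableSpace G]
    [MeasurableSingletonClass G] {p : G → X} {A : Set G} (hi : InjOn p A)
    (x : X) : Measure.count (A ∩ p ⁻¹' {x}) = (p '' A).indicator (fun _ => (1 : ℝ≥0∞)) x := by
  by_cases hx : x ∈ p '' A
  · obtain ⟨a, ha, rfl⟩ := hx
    have : A ∩ p ⁻¹' {p a} = {a} := by
      ext b
      constructor
      · rintro ⟨hb, h⟩
        exact hi hb ha h
      · rintro rfl
        exact ⟨ha, rfl⟩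
    rw [this, Measure.count_singleton, indicator_of_mem (mem_image_of_mem p ha)]
  · have : A ∩ p ⁻¹' {x} = ∅ := by
      ext b
      simp only [mem_inter_iff, mem_preimage, mem_singleton_iff, mem_empty_iff_false, iff_false]
      rintro ⟨hb, rfl⟩
      exact hx ⟨b, hb, rfl⟩
    rw [this, indicator_of_notMem hx, measure_empty]

variable [MeasurableSpace G] [BorelSpace G] [MeasurableSpace X] [BorelSpace X]

/-- Since `p` restricts to an open embedding of `U`, images of Borel subsets of `U` are Borel by
elementary means. -/
theorem IsLocalHomeomorph.measurableSet_image_of_injOn {p : G → X}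
    (hp : IsLocalHomeomorph p) {U A : Set G} (hU : IsOpen U) (hi : InjOn p U) (hAU : A ⊆ U)
    (hA : MeasurableSet A) : MeasurableSet (p '' A) := by
  have h := (hp.isOpenEmbedding_restrict_of_injOn hU hi).measurableEmbedding.measurableSet_image'
    (measurable_subtype_coe hA)
  convert h using 1
  ext x
  constructor
  · rintro ⟨a, ha, rfl⟩
    exact ⟨⟨a, hAU ha⟩, ha, rfl⟩
  · rintro ⟨a, ha, rfl⟩
    exact ⟨a, ha, rfl⟩

variable [T1Space X] [T1Space G] [SecondCountableTopology G]

/-- Cutting `A` into countably many disjoint Borel pieces on which `p` is injective turns the number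
of points of `A` over `x` into a sum of indicators of the images of the pieces, which are
measurable. -/
theorem IsLocalHomeomorph.measurable_count_restrict {p : G → X} (hp : IsLocalHomeomorph p) :
    Measurable fun x => (Measure.count : Measure G).restrict (p ⁻¹' {x}) := by
  obtain ⟨U, hUo, hUi, hU⟩ := hp.exists_countable_cover
  refine Measure.measurable_of_measurable_coe _ fun A hA => ?_
  have hAm : ∀ n, MeasurableSet (A ∩ disjointed U n) := fun n =>
    hA.inter (MeasurableSet.disjointed (fun n => (hUo n).measurableSet) n)
  have hAU : ∀ n, A ∩ disjointed U n ⊆ U n := fun n =>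
    inter_subset_right.trans (disjointed_subset U n)
  have : ∀ x, (Measure.count : Measure G).restrict (p ⁻¹' {x}) A =
      ∑' n, (p '' (A ∩ disjointed U n)).indicator (fun _ => (1 : ℝ≥0∞)) x := by
    intro x
    rw [Measure.restrict_apply hA]
    have hpx : MeasurableSet (p ⁻¹' {x}) :=
      hp.continuous.measurable (measurableSet_singleton x)
    have e : A ∩ p ⁻¹' {x} = ⋃ n, (A ∩ disjointed U n) ∩ p ⁻¹' {x} := by
      rw [← iUnion_inter, ← inter_iUnion, iUnion_disjointed, hU, inter_univ]
    rw [e, measure_iUnion]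
    · exact tsum_congr fun n => count_fiber_inter ((hUi n).mono (hAU n)) x
    · intro i j hij
      exact (disjoint_disjointed U hij).mono (inter_subset_left.trans inter_subset_right)
        (inter_subset_left.trans inter_subset_right)
    · exact fun n => (hAm n).inter hpx
  simp_rw [this]
  exact Measurable.tsum fun n => measurable_const.indicator
    (hp.measurableSet_image_of_injOn (hUo n) (hUi n) (hAU n) (hAm n))

/-- The kernel which sends `x` to the counting measure on the fibre of `p` over `x`. -/
noncomputable def fiberKernel (p : G → X) (hp : IsLocalHomeomorph p) :
    ProbabilityTheory.Kernel X G :=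
  ⟨fun x => Measure.count.restrict (p ⁻¹' {x}), hp.measurable_count_restrict⟩

theorem fiberKernel_apply {p : G → X} (hp : IsLocalHomeomorph p) (x : X) :
    fiberKernel p hp x = Measure.count.restrict (p ⁻¹' {x}) := rfl

theorem lintegral_fiberKernel {p : G → X} (hp : IsLocalHomeomorph p) (x : X) (u : G → ℝ≥0∞) :
    ∫⁻ g, u g ∂(fiberKernel p hp x) = ∑' g : {g : G // p g = x}, u g := by
  have hpx : MeasurableSet (p ⁻¹' {x}) := hp.continuous.measurable (measurableSet_singleton x)
  rw [fiberKernel_apply, ← lintegral_indicator hpx, lintegral_count]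
  exact (tsum_subtype {g | p g = x} u).symm

theorem integral_fiberKernel {p : G → X} (hp : IsLocalHomeomorph p) (x : X) (u : G → ℂ)
    (hu : Integrable u (fiberKernel p hp x)) :
    ∫ g, u g ∂(fiberKernel p hp x) = ∑' g : {g : G // p g = x}, u g := by
  rw [fiberKernel_apply] at hu ⊢
  rw [setIntegral_countable u (hp.countable_fiber x) hu]
  simp only [Measure.real, Measure.count_singleton, ENNReal.toReal_one, one_smul]
  rfl

/-- The measure on `G` obtained by integrating the counting measures on the fibres of `p`. -/
noncomputable def fiberMeasure (p : G → X) (hp : IsLocalHomeomorph p) (m : Measure X) :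
    Measure G :=
  m.bind (fiberKernel p hp)

variable {p : G → X} (hp : IsLocalHomeomorph p) (m : Measure X)

theorem lintegral_fiberMeasure {u : G → ℝ≥0∞} (hu : Measurable u) :
    ∫⁻ g, u g ∂(fiberMeasure p hp m) = ∫⁻ x, ∑' g : {g : G // p g = x}, u g ∂m := by
  rw [fiberMeasure, Measure.lintegral_bind (ProbabilityTheory.Kernel.aemeasurable _)
    hu.aemeasurable]
  simp_rw [lintegral_fiberKernel]

theorem integral_fiberMeasure {u : G → ℂ} (hu : Integrable u (fiberMeasure p hp m)) :
    Integrable (fun x => ∑' g : {g : G // p g = x}, u g) m ∧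
    ∫ g, u g ∂(fiberMeasure p hp m) = ∫ x, ∑' g : {g : G // p g = x}, u g ∂m := by
  -- Writing the measure as a composition with a constant kernel on a one-point space makes the
  -- Bochner version of Fubini for kernels applicable.
  have e : fiberMeasure p hp m =
      ((fiberKernel p hp).comp (ProbabilityTheory.Kernel.const Unit m)) () :=
    Measure.comp_eq_comp_const_apply
  have hm : m = ProbabilityTheory.Kernel.const Unit m () := by simp
  rw [e] at hu
  have hae : (fun x => ∑' g : {g : G // p g = x}, u g)
      =ᵐ[m] fun x => ∫ g, u g ∂(fiberKernel p hp x) := by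
    have := hu.ae_of_comp
    rw [← hm] at this
    filter_upwards [this] with x hx
    rw [integral_fiberKernel hp x u hx]
  refine ⟨(integrable_congr hae).2 ?_, ?_⟩
  · have := hu.integral_comp
    rwa [← hm] at this
  · rw [integral_congr_ae hae, e, ProbabilityTheory.Kernel.integral_comp hu, ← hm]

theorem fiberMeasure_apply_of_injOn {W : Set G} (hW : MeasurableSet W) (hi : InjOn p W)
    (hWm : MeasurableSet (p '' W)) :
    fiberMeasure p hp m W = m (p '' W) := by
  rw [fiberMeasure, Measure.bind_apply hW (ProbabilityTheory.Kernel.aemeasurable _),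
    ← lintegral_indicator_one hWm]
  refine lintegral_congr fun x => ?_
  rw [fiberKernel_apply, Measure.restrict_apply hW]
  exact count_fiber_inter hi x

end FiberMeasure

/-! ### Sums along the fibres of a local homeomorphism depend continuously on parameters -/

/-- A partition of unity on `K`, subordinate to finitely many charts of `p`, splits the sum into
finitely many sums with at most one non-zero term each. That term is evaluated at the local inverse
of `p` applied to `q y`, and so varies continuously. Continuity of `Φ` is required only where `p h =
q y`, because a groupoid product is continuous only on composable pairs. -/
theorem IsLocalHomeomorph.continuous_tsum_fiber {G X Y : Type*} [TopologicalSpace G]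
    [TopologicalSpace X] [TopologicalSpace Y] [T2Space G] [LocallyCompactSpace G] [T2Space X]
    {p : G → X} (hp : IsLocalHomeomorph p) {q : Y → X} (hq : Continuous q) {Φ : G → Y → ℂ}
    (hΦ : ContinuousOn (fun z : G × Y => Φ z.1 z.2) {z | p z.1 = q z.2}) {K : Set G}
    (hK : IsCompact K) (hΦK : ∀ h y, p h = q y → h ∉ K → Φ h y = 0) :
    Continuous fun y => ∑' h : {h : G // p h = q y}, Φ h y := by
  classical
  choose e he hpe using hp
  obtain ⟨t, -, ht⟩ := hK.elim_nhds_subcover (fun g => (e g).source)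
    (fun g _ => (e g).open_source.mem_nhds (he g))
  have ht' : K ⊆ ⋃ i : Fin t.card, (e (t.equivFin.symm i)).source := by
    intro h hh
    obtain ⟨i, hi, hi'⟩ := Set.mem_iUnion₂.1 (ht hh)
    exact Set.mem_iUnion.2 ⟨t.equivFin ⟨i, hi⟩, by simpa using hi'⟩
  obtain ⟨χ, hχU, hχ1, -, hχc⟩ := exists_continuous_sum_one_of_isOpen_isCompact
    (fun i => (e (t.equivFin.symm i)).open_source) hK ht'
  -- the summand of a single member of the partition of unity
  have hsingle : ∀ i y (h₀ : {h : G // p h = q y}),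
      (h₀ : G) ∈ (e (t.equivFin.symm i)).source → ∀ h : {h : G // p h = q y}, h ≠ h₀ →
      (χ i h : ℂ) * Φ h y = 0 := by
    intro i y h₀ hh₀ h hne
    have : (h : G) ∉ (e (t.equivFin.symm i)).source := by
      intro hh
      apply hne
      refine Subtype.ext ((e (t.equivFin.symm i)).injOn hh hh₀ ?_)
      rw [← hpe, h.2, h₀.2]
    have : χ i h = 0 := image_eq_zero_of_notMem_tsupport fun h' => this (hχU i h')
    simp [this]
  have hfin : ∀ i y, (Function.support fun h : {h : G // p h = q y} =>
      (χ i h : ℂ) * Φ h y).Finite := by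
    intro i y
    rcases (Function.support fun h : {h : G // p h = q y} =>
      (χ i h : ℂ) * Φ h y).eq_empty_or_nonempty with h0 | ⟨h₀, hh₀⟩
    · rw [h0]; exact Set.finite_empty
    · refine (Set.finite_singleton h₀).subset fun h hh => ?_
      by_contra hne
      refine hh (hsingle i y h₀ (hχU i (subset_tsupport _ fun h' => hh₀ ?_)) h hne)
      simp [h']
  have hsum : ∀ y, ∑' h : {h : G // p h = q y}, Φ h y
      = ∑ i, ∑' h : {h : G // p h = q y}, (χ i h : ℂ) * Φ h y := by
    intro y
    rw [← Summable.tsum_finsetSum fun i _ => summable_of_hasFiniteSupport (hfin i y)]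
    refine tsum_congr fun h => ?_
    by_cases hh : (h : G) ∈ K
    · have := hχ1 hh
      simp only [Finset.sum_apply, Pi.one_apply] at this
      rw [← Finset.sum_mul, ← Complex.ofReal_sum, this, Complex.ofReal_one, one_mul]
    · simp [hΦK h y h.2 hh]
  simp_rw [hsum]
  refine continuous_finsetSum _ fun i _ => ?_
  set E := e (t.equivFin.symm i) with hE
  rw [continuous_iff_continuousAt]
  intro y₀
  by_cases hy : q y₀ ∈ E.target
  · have hev : ∀ᶠ y in 𝓝 y₀, q y ∈ E.target :=
      hq.continuousAt.eventually_mem (E.open_target.mem_nhds hy)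
    have hpE : ∀ y, q y ∈ E.target → p (E.symm (q y)) = q y := fun y h => by
      rw [hpe (t.equivFin.symm i)]; exact E.right_inv h
    have hco : ContinuousAt (fun y => (χ i (E.symm (q y)) : ℂ) * Φ (E.symm (q y)) y) y₀ := by
      have h1 : ContinuousAt (fun y => E.symm (q y)) y₀ :=
        ContinuousAt.comp (f := q) (E.continuousAt_symm hy) hq.continuousAt
      refine ContinuousAt.mul ?_ ?_
      · exact Complex.continuous_ofReal.continuousAt.comp
          ((χ i).continuous.continuousAt.comp h1)
      · have h2 := hΦ (E.symm (q y₀), y₀) (hpE y₀ hy)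
        have h3 : Tendsto (fun y => (E.symm (q y), y)) (𝓝 y₀)
            (𝓝[{z | p z.1 = q z.2}] (E.symm (q y₀), y₀)) :=
          tendsto_nhdsWithin_iff.2 ⟨h1.prodMk continuousAt_id, hev.mono fun y h => hpE y h⟩
        exact h2.tendsto.comp h3
    refine hco.congr (hev.mono fun y h => ?_)
    let h₀ : {h : G // p h = q y} := ⟨E.symm (q y), hpE y h⟩
    exact (tsum_eq_single h₀ (hsingle i y h₀ (E.map_target h))).symm
  -- When `q y₀` is outside the chart target, it misses the image of the support of `χ i`. This
  -- image is compact, hence closed, so the sum vanishes for all `y` near `y₀`.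
  · have hC : IsClosed (p '' tsupport (χ i)) :=
      ((hχc i).isCompact.image_of_continuousOn (by
        rw [hpe (t.equivFin.symm i)]
        exact E.continuousOn.mono (hχU i))).isClosed
    have hn : q y₀ ∉ p '' tsupport (χ i) := by
      rintro ⟨h, hh, hh'⟩
      rw [← hh', hpe (t.equivFin.symm i)] at hy
      exact hy (E.map_source (hχU i hh))
    have hev : ∀ᶠ y in 𝓝 y₀, q y ∉ p '' tsupport (χ i) :=
      hq.continuousAt.eventually_mem (hC.isOpen_compl.mem_nhds hn)
    refine (continuousAt_const (y := (0 : ℂ))).congr (hev.mono fun y h => ?_)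
    refine ((tsum_congr fun h' => ?_).trans tsum_zero).symm
    have : χ i h' = 0 := image_eq_zero_of_notMem_tsupport fun h'' =>
      h (h'.2 ▸ mem_image_of_mem p h'')
    simp [this]

/-! ### Groupoid identities -/

namespace EtaleGroupoid

variable {G X : Type*} [TopologicalSpace G] [TopologicalSpace X] (𝒢 : EtaleGroupoid G X)

theorem continuous_r : Continuous 𝒢.r := 𝒢.isLocalHomeomorph_r.continuous

theorem isEmbedding_unit : IsEmbedding 𝒢.unit :=
  Topology.IsEmbedding.of_leftInverse 𝒢.r_unit 𝒢.continuous_r 𝒢.continuous_unit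

theorem t2Space_unit [T2Space G] {𝒢 : EtaleGroupoid G X} : T2Space X :=
  𝒢.isEmbedding_unit.t2Space

theorem mul_inv_cancel_right (g k : G) (e : 𝒢.s g = 𝒢.r k) :
    𝒢.mul (𝒢.mul g k) (𝒢.inv k) = g := by
  rw [𝒢.mul_assoc _ _ _ e (𝒢.r_inv k).symm, 𝒢.mul_inv, ← e, 𝒢.mul_unit]

theorem inv_mul_cancel_right (g k : G) (e : 𝒢.s g = 𝒢.s k) :
    𝒢.mul (𝒢.mul g (𝒢.inv k)) k = g := by
  have := 𝒢.mul_inv_cancel_right g (𝒢.inv k) (e.trans (𝒢.r_inv k).symm)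
  rwa [𝒢.inv_inv] at this

theorem eq_inv_of_mul_eq_unit {g k : G} (e : 𝒢.s g = 𝒢.r k) {x : X}
    (h : 𝒢.mul g k = 𝒢.unit x) : g = 𝒢.inv k := by
  have hx : x = 𝒢.r (𝒢.inv k) := by
    rw [𝒢.r_inv, ← 𝒢.s_mul g k e, h, 𝒢.s_unit]
  rw [← 𝒢.mul_inv_cancel_right g k e, h, hx, 𝒢.unit_mul]

theorem inv_mul_inv (g k : G) (e : 𝒢.s g = 𝒢.s k) :
    𝒢.inv (𝒢.mul g (𝒢.inv k)) = 𝒢.mul k (𝒢.inv g) := by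
  have h1 : 𝒢.s k = 𝒢.r (𝒢.inv g) := by rw [𝒢.r_inv, e]
  have h2 : 𝒢.s g = 𝒢.r (𝒢.inv k) := by rw [𝒢.r_inv, e]
  refine (𝒢.eq_inv_of_mul_eq_unit (x := 𝒢.r k) ?_ ?_).symm
  · rw [𝒢.s_mul _ _ h1, 𝒢.s_inv, 𝒢.r_mul _ _ h2]
  · rw [𝒢.mul_assoc _ _ _ h1 (by rw [𝒢.s_inv, 𝒢.r_mul _ _ h2]), 𝒢.inv_mul_cancel_left _ _ h2,
      𝒢.mul_inv]

/-! ### Matrix coefficients of operators on `ℓ²(G)` -/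

theorem delta_apply {G : Type*} [DecidableEq G] (k g : G) :
    delta k g = if g = k then (1 : ℂ) else 0 := by
  unfold delta
  by_cases h : g = k
  · subst h; simp
  · simp [h]

theorem norm_delta {G : Type*} (g : G) : ‖delta g‖ = 1 := by
  classical
  simp [delta]

theorem inner_delta_left {G : Type*} (g : G) (ψ : L2 G) : inner ℂ (delta g) ψ = ψ g := by
  classical
  unfold delta
  rw [lp.inner_single_left]
  simp

/-- Every vector is the norm-convergent sum of its components along the point masses, so operator
identities can be checked on matrix coefficients. -/
theorem ext_delta {G : Type*} {S T : L2 G →L[ℂ] L2 G}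
    (h : ∀ k g, S (delta k) g = T (delta k) g) : S = T := by
  classical
  refine ContinuousLinearMap.ext fun ψ => ?_
  have hψ := lp.hasSum_single (p := 2) (by simp) ψ
  refine (hψ.mapL S).unique ?_
  convert hψ.mapL T using 2 with k
  have e : lp.single 2 k (ψ k) = ψ k • delta k := by
    rw [delta, ← lp.single_smul, smul_eq_mul, mul_one]
  rw [e, map_smul, map_smul]
  congr 1
  ext g
  exact h k g

theorem star_apply_delta {G : Type*} (T : L2 G →L[ℂ] L2 G) (k g : G) :
    star T (delta k) g = star (T (delta g) k) := by
  rw [← inner_delta_left g, ContinuousLinearMap.star_eq_adjoint,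
    ContinuousLinearMap.adjoint_inner_right, ← inner_conj_symm, inner_delta_left]
  rfl

/-- Only h = g k⁻¹ can satisfy h⁻¹ g = k, and this product makes sense exactly when `s g = s k`. -/
theorem conv_delta [DecidableEq X] (f : G → ℂ) (k g : G) :
    𝒢.conv f (delta k) g = if 𝒢.s g = 𝒢.s k then f (𝒢.mul g (𝒢.inv k)) else 0 := by
  classical
  unfold conv
  split_ifs with e
  · have hr : 𝒢.r (𝒢.mul g (𝒢.inv k)) = 𝒢.r g := 𝒢.r_mul _ _ (by rw [𝒢.r_inv, e])
    rw [tsum_eq_single ⟨𝒢.mul g (𝒢.inv k), hr⟩]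
    · have : 𝒢.mul (𝒢.inv (𝒢.mul g (𝒢.inv k))) g = k := by
        rw [𝒢.inv_mul_inv _ _ e, 𝒢.inv_mul_cancel_right _ _ e.symm]
      simp [this, delta_apply]
    · rintro ⟨h, hh⟩ hne
      have : 𝒢.mul (𝒢.inv h) g ≠ k := by
        rintro rfl
        apply hne
        have h1 : 𝒢.s (𝒢.inv h) = 𝒢.r g := by rw [𝒢.s_inv, hh]
        have h2 := 𝒢.mul_inv_cancel_left h g hh
        have h3 := 𝒢.mul_inv_cancel_right h (𝒢.mul (𝒢.inv h) g)
          (by rw [𝒢.r_mul _ _ h1, 𝒢.r_inv])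
        rw [h2] at h3
        exact Subtype.ext h3.symm
      simp [this, delta_apply]
  · refine (tsum_congr fun h => ?_).trans tsum_zero
    have : 𝒢.mul (𝒢.inv h) g ≠ k := by
      rintro rfl
      exact e (𝒢.s_mul _ _ ((𝒢.s_inv _).trans h.2)).symm
    simp [this, delta_apply]

theorem regRep_delta [DecidableEq X] (f : C_c(G, ℂ)) (k g : G) :
    𝒢.regRep f (delta k) g = if 𝒢.s g = 𝒢.s k then f (𝒢.mul g (𝒢.inv k)) else 0 :=
  (𝒢.regRep_apply f (delta k) g).trans (𝒢.conv_delta f k g)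

/-- The involution `f*(g) = conj f(g⁻¹)` of `C_c(G)`. -/
noncomputable def ccStar (f : C_c(G, ℂ)) : C_c(G, ℂ) where
  toFun g := star (f (𝒢.inv g))
  continuous_toFun := (f.continuous.comp 𝒢.continuous_inv).star
  hasCompactSupport' := by
    let e : G ≃ₜ G :=
      { toFun := 𝒢.inv, invFun := 𝒢.inv, left_inv := 𝒢.inv_inv, right_inv := 𝒢.inv_inv,
        continuous_toFun := 𝒢.continuous_inv, continuous_invFun := 𝒢.continuous_inv }
    exact (f.hasCompactSupport.comp_homeomorph e).comp_left (g := star) (star_zero ℂ)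

theorem ccStar_apply (f : C_c(G, ℂ)) (g : G) : 𝒢.ccStar f g = star (f (𝒢.inv g)) := rfl

theorem regRep_ccStar (f : C_c(G, ℂ)) : 𝒢.regRep (𝒢.ccStar f) = star (𝒢.regRep f) := by
  classical
  refine ext_delta fun k g => ?_
  rw [star_apply_delta, regRep_delta, regRep_delta]
  by_cases e : 𝒢.s g = 𝒢.s k
  · rw [if_pos e, if_pos e.symm, ccStar_apply, 𝒢.inv_mul_inv _ _ e]
  · rw [if_neg e, if_neg (Ne.symm e), star_zero]

variable [T2Space G] [LocallyCompactSpace G]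

/-- The convolution product of `C_c(G)`. -/
noncomputable def ccConv (f f' : C_c(G, ℂ)) : C_c(G, ℂ) where
  toFun := 𝒢.conv f f'
  continuous_toFun := by
    have := 𝒢.t2Space_unit
    refine 𝒢.isLocalHomeomorph_r.continuous_tsum_fiber 𝒢.continuous_r
      (Φ := fun h g => f h * f' (𝒢.mul (𝒢.inv h) g)) ?_ f.hasCompactSupport.isCompact ?_
    · refine (f.continuous.comp continuous_fst).continuousOn.mul
        (f'.continuous.comp_continuousOn ?_)
      refine 𝒢.continuous_mul.comp (f := fun z : G × G => (𝒢.inv z.1, z.2))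
        ((𝒢.continuous_inv.comp continuous_fst).prodMk continuous_snd).continuousOn ?_
      rintro ⟨h, g⟩ e
      exact (𝒢.s_inv h).trans e
    · intro h g _ hh
      rw [image_eq_zero_of_notMem_tsupport hh, zero_mul]
  hasCompactSupport' := by
    have := 𝒢.t2Space_unit
    -- The support lies in the set of products of composable pairs from the two supports.
    -- Composability is a closed condition because `X` is Hausdorff, so that set is compact.
    have hK : IsCompact ((fun z : G × G => 𝒢.mul z.1 z.2) ''
        ((tsupport f ×ˢ tsupport f') ∩ {z | 𝒢.s z.1 = 𝒢.r z.2})) := by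
      refine IsCompact.image_of_continuousOn ?_ (𝒢.continuous_mul.mono inter_subset_right)
      exact (f.hasCompactSupport.isCompact.prod f'.hasCompactSupport.isCompact).inter_right
        (isClosed_eq (𝒢.continuous_s.comp continuous_fst) (𝒢.continuous_r.comp continuous_snd))
    refine HasCompactSupport.intro hK fun g hg => ?_
    refine (tsum_congr fun h => ?_).trans tsum_zero
    by_contra h0
    refine hg ⟨(h, 𝒢.mul (𝒢.inv h) g), ⟨⟨?_, ?_⟩, ?_⟩, 𝒢.mul_inv_cancel_left _ _ h.2⟩
    · exact subset_tsupport _ (left_ne_zero_of_mul h0)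
    · exact subset_tsupport _ (right_ne_zero_of_mul h0)
    · change 𝒢.s h = 𝒢.r (𝒢.mul (𝒢.inv h) g)
      rw [𝒢.r_mul _ _ ((𝒢.s_inv _).trans h.2), 𝒢.r_inv]

theorem ccConv_apply (f f' : C_c(G, ℂ)) (g : G) : 𝒢.ccConv f f' g = 𝒢.conv f f' g := rfl

/-- The coefficient of the product at (k, g) is the convolution sum at g k⁻¹. The two index sets
agree since r(g k⁻¹) = r(g), and the terms agree by associativity. -/
theorem regRep_ccConv (f f' : C_c(G, ℂ)) :
    𝒢.regRep (𝒢.ccConv f f') = 𝒢.regRep f * 𝒢.regRep f' := by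
  classical
  refine ext_delta fun k g => ?_
  rw [regRep_delta, mul_apply_eq_comp, regRep_apply]
  simp_rw [regRep_delta]
  by_cases e : 𝒢.s g = 𝒢.s k
  · have h2 : 𝒢.s g = 𝒢.r (𝒢.inv k) := by rw [𝒢.r_inv, e]
    have hr : 𝒢.r (𝒢.mul g (𝒢.inv k)) = 𝒢.r g := 𝒢.r_mul _ _ h2
    rw [if_pos e, ccConv_apply, conv]
    refine Eq.trans (Equiv.tsum_eq (Equiv.subtypeEquivRight fun h => by rw [hr]) _).symm
      (tsum_congr fun h => ?_)
    have h3 : 𝒢.s (𝒢.inv h) = 𝒢.r g := (𝒢.s_inv _).trans h.2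
    rw [𝒢.s_mul _ _ h3, if_pos e, 𝒢.mul_assoc _ _ _ h3 h2]
    rfl
  · rw [if_neg e]
    refine ((tsum_congr fun h => ?_).trans tsum_zero).symm
    rw [𝒢.s_mul _ _ ((𝒢.s_inv _).trans h.2), if_neg e, mul_zero]

end EtaleGroupoid

/-! ### Elements of C*_r(G) as continuous functions on G -/

namespace EtaleGroupoid

variable {G X : Type*} [TopologicalSpace G] [TopologicalSpace X] (𝒢 : EtaleGroupoid G X)

theorem toCstarR_ccStar (f : C_c(G, ℂ)) : 𝒢.toCstarR (𝒢.ccStar f) = star (𝒢.toCstarR f) :=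
  Subtype.ext (𝒢.regRep_ccStar f)

/-- The function on `G` defined by an element of `C*_r(G)`. -/
noncomputable def coeff : 𝒢.CstarR →ₗ[ℂ] (G → ℂ) where
  toFun a g := (a : L2 G →L[ℂ] L2 G) (delta (𝒢.unit (𝒢.s g))) g
  map_add' a b := by ext g; simp
  map_smul' c a := by ext g; simp

theorem coeff_apply (a : 𝒢.CstarR) (g : G) :
    𝒢.coeff a g = (a : L2 G →L[ℂ] L2 G) (delta (𝒢.unit (𝒢.s g))) g := rfl

theorem inv_unit (x : X) : 𝒢.inv (𝒢.unit x) = 𝒢.unit x := by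
  have h : 𝒢.mul (𝒢.unit x) (𝒢.unit x) = 𝒢.unit x := by
    have := 𝒢.unit_mul (𝒢.unit x)
    rwa [𝒢.r_unit] at this
  exact (𝒢.eq_inv_of_mul_eq_unit (by rw [𝒢.s_unit, 𝒢.r_unit]) h).symm

theorem coeff_toCstarR (f : C_c(G, ℂ)) (g : G) : 𝒢.coeff (𝒢.toCstarR f) g = f g := by
  classical
  refine (𝒢.regRep_delta f _ _).trans ?_
  rw [if_pos (𝒢.s_unit _).symm, 𝒢.inv_unit, 𝒢.mul_unit]

theorem condExp_eq_coeff (a : 𝒢.CstarR) (x : X) : 𝒢.condExp a x = 𝒢.coeff a (𝒢.unit x) := by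
  rw [coeff_apply, 𝒢.s_unit]
  rfl

theorem norm_apply_delta_le (a : 𝒢.CstarR) (k g : G) :
    ‖(a : L2 G →L[ℂ] L2 G) (delta k) g‖ ≤ ‖a‖ := by
  calc _ ≤ ‖(a : L2 G →L[ℂ] L2 G) (delta k)‖ := lp.norm_apply_le_norm (by simp) _ _
    _ ≤ ‖(a : L2 G →L[ℂ] L2 G)‖ * ‖delta k‖ := ContinuousLinearMap.le_opNorm _ _
    _ = ‖a‖ := by rw [norm_delta, mul_one]; rfl

theorem continuous_apply_delta (k g : G) :
    Continuous fun a : 𝒢.CstarR => (a : L2 G →L[ℂ] L2 G) (delta k) g := by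
  refine AddMonoidHomClass.continuous_of_bound
    (AddMonoidHom.mk' (fun a : 𝒢.CstarR => (a : L2 G →L[ℂ] L2 G) (delta k) g) (by simp)) 1
    fun a => ?_
  rw [one_mul]
  exact 𝒢.norm_apply_delta_le a k g

theorem condExp_star_mul (a b : 𝒢.CstarR) (x : X) :
    𝒢.condExp (star a * b) x = inner ℂ ((a : L2 G →L[ℂ] L2 G) (delta (𝒢.unit x)))
      ((b : L2 G →L[ℂ] L2 G) (delta (𝒢.unit x))) := by
  have : 𝒢.condExp (star a * b) x = (star (a : L2 G →L[ℂ] L2 G))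
    ((b : L2 G →L[ℂ] L2 G) (delta (𝒢.unit x))) (𝒢.unit x) := rfl
  rw [this, ← inner_delta_left, ContinuousLinearMap.star_eq_adjoint,
    ContinuousLinearMap.adjoint_inner_right]

theorem condExp_star_mul_self (a : 𝒢.CstarR) (x : X) :
    𝒢.condExp (star a * a) x =
      ((‖(a : L2 G →L[ℂ] L2 G) (delta (𝒢.unit x))‖ ^ 2 : ℝ) : ℂ) := by
  rw [condExp_star_mul, inner_self_eq_norm_sq_to_K]
  push_cast
  rfl

variable [T2Space G] [LocallyCompactSpace G]

/-- By `regRep_ccConv` and `regRep_ccStar` the image of C_c(G) is already a *-algebra, so passing to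
the generated *-algebra adds nothing before the closure is taken. -/
theorem denseRange_toCstarR : DenseRange 𝒢.toCstarR := by
  let S : NonUnitalStarSubalgebra ℂ (L2 G →L[ℂ] L2 G) :=
    { (LinearMap.range 𝒢.regRep) with
      mul_mem' := by
        rintro _ _ ⟨f, rfl⟩ ⟨f', rfl⟩
        exact ⟨𝒢.ccConv f f', 𝒢.regRep_ccConv f f'⟩
      star_mem' := by
        rintro _ ⟨f, rfl⟩
        exact ⟨𝒢.ccStar f, 𝒢.regRep_ccStar f⟩ }
  have hS : NonUnitalStarAlgebra.adjoin ℂ (Set.range 𝒢.regRep) ≤ S :=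
    NonUnitalStarAlgebra.adjoin_le (by rintro _ ⟨f, rfl⟩; exact ⟨f, rfl⟩)
  intro a
  have ha : (a : L2 G →L[ℂ] L2 G) ∈ closure (S : Set (L2 G →L[ℂ] L2 G)) :=
    closure_mono (show _ ⊆ (S : Set _) from hS) a.2
  rw [Metric.mem_closure_iff] at ha ⊢
  intro ε hε
  obtain ⟨_, ⟨f, rfl⟩, hf⟩ := ha ε hε
  exact ⟨𝒢.toCstarR f, ⟨f, rfl⟩, hf⟩

/-- Matrix coefficients are bounded by the norm, so norm approximation by C_c(G) gives uniform
approximation of the coefficient function by continuous functions. -/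
theorem continuous_coeff (a : 𝒢.CstarR) : Continuous (𝒢.coeff a) := by
  refine continuous_of_uniform_approx_of_continuous fun u hu => ?_
  obtain ⟨ε, hε, hεu⟩ := Metric.mem_uniformity_dist.1 hu
  obtain ⟨_, ⟨f, rfl⟩, hf⟩ := Metric.mem_closure_iff.1 (𝒢.denseRange_toCstarR a) ε hε
  refine ⟨f, f.continuous, fun g => hεu ?_⟩
  rw [← 𝒢.coeff_toCstarR f g, dist_eq_norm]
  have : 𝒢.coeff a g - 𝒢.coeff (𝒢.toCstarR f) g = 𝒢.coeff (a - 𝒢.toCstarR f) g := by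
    rw [map_sub]; rfl
  rw [this]
  refine (𝒢.norm_apply_delta_le (a - 𝒢.toCstarR f) _ g).trans_lt ?_
  rwa [← dist_eq_norm]

theorem continuous_condExp (a : 𝒢.CstarR) : Continuous (𝒢.condExp a) := by
  have : 𝒢.condExp a = 𝒢.coeff a ∘ 𝒢.unit := funext fun x => 𝒢.condExp_eq_coeff a x
  rw [this]
  exact (𝒢.continuous_coeff a).comp 𝒢.continuous_unit

theorem coeff_star (a : 𝒢.CstarR) (g : G) : 𝒢.coeff (star a) g = star (𝒢.coeff a (𝒢.inv g)) := by
  refine 𝒢.denseRange_toCstarR.induction_on a (isClosed_eq ?_ ?_) fun f => ?_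
  · exact (𝒢.continuous_apply_delta _ _).comp continuous_star
  · exact (𝒢.continuous_apply_delta _ _).star
  · rw [← toCstarR_ccStar, coeff_toCstarR, coeff_toCstarR, ccStar_apply]

/-- The image of the point mass at a unit x stays in ℓ²(s⁻¹(x)). This confines the inner product in
`condExp_star_mul` to the fibre of `s` over `x`. -/
theorem apply_delta_unit_of_ne (a : 𝒢.CstarR) {x : X} {g : G} (h : 𝒢.s g ≠ x) :
    (a : L2 G →L[ℂ] L2 G) (delta (𝒢.unit x)) g = 0 := by
  classical
  refine 𝒢.denseRange_toCstarR.induction_on a (isClosed_eq ?_ continuous_const) fun f => ?_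
  · exact 𝒢.continuous_apply_delta _ _
  · refine (𝒢.regRep_delta f _ _).trans ?_
    rw [if_neg (by rwa [𝒢.s_unit])]

theorem hasSum_condExp_star_mul (a b : 𝒢.CstarR) (x : X) :
    HasSum (fun g : {g : G // 𝒢.s g = x} => star (𝒢.coeff a g) * 𝒢.coeff b g)
      (𝒢.condExp (star a * b) x) := by
  have h := lp.hasSum_inner (𝕜 := ℂ) ((a : L2 G →L[ℂ] L2 G) (delta (𝒢.unit x)))
      ((b : L2 G →L[ℂ] L2 G) (delta (𝒢.unit x)))
  rw [← condExp_star_mul] at h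
  have h2 := (hasSum_subtype_iff_of_support_subset (s := {g | 𝒢.s g = x}) ?_).2 h
  · have e : (fun g : {g : G // 𝒢.s g = x} => star (𝒢.coeff a g) * 𝒢.coeff b g) =
        fun g : {g : G // 𝒢.s g = x} => inner ℂ ((a : L2 G →L[ℂ] L2 G) (delta (𝒢.unit x)) g)
          ((b : L2 G →L[ℂ] L2 G) (delta (𝒢.unit x)) g) := by
      funext g
      rw [coeff_apply, coeff_apply, g.2, RCLike.inner_apply, mul_comm]
      rfl
    rw [e]
    exact h2
  · intro g hg
    by_contra hne
    refine hg ?_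
    change inner ℂ _ ((b : L2 G →L[ℂ] L2 G) (delta (𝒢.unit x)) g) = 0
    rw [𝒢.apply_delta_unit_of_ne b hne, inner_zero_right]

theorem ofReal_condExp_star_mul_self (a : 𝒢.CstarR) (x : X) :
    ENNReal.ofReal (𝒢.condExp (star a * a) x).re =
      ∑' g : {g : G // 𝒢.s g = x}, ‖𝒢.coeff a g‖ₑ ^ 2 := by
  have h := Complex.hasSum_re (𝒢.hasSum_condExp_star_mul a a x)
  have e : ∀ g, (star (𝒢.coeff a g) * 𝒢.coeff a g).re = ‖𝒢.coeff a g‖ ^ 2 := by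
    intro g
    rw [Complex.star_def, ← Complex.normSq_eq_conj_mul_self, Complex.ofReal_re,
      Complex.normSq_eq_norm_sq]
  simp_rw [e] at h
  rw [← h.tsum_eq, ENNReal.ofReal_tsum_of_nonneg (fun _ => by positivity) h.summable]
  refine tsum_congr fun g => ?_
  rw [ENNReal.ofReal_pow (norm_nonneg _), ofReal_norm]

end EtaleGroupoid

/-! ### The linear extension of a weight -/

namespace CStarWeight

variable {A : Type*} [NonUnitalCStarAlgebra A]

theorem star_mul_self_mem_posCone (a : A) : star a * a ∈ posCone A := ⟨a, rfl⟩

theorem isClosed_posCone : IsClosed (posCone A) := by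
  let _ := CStarAlgebra.spectralOrder A
  have := CStarAlgebra.spectralOrderedRing A
  have : posCone A = {a | 0 ≤ a} := by
    ext a
    exact CStarAlgebra.nonneg_iff_eq_star_mul_self.symm
  rw [this]
  exact CStarAlgebra.isClosed_nonneg

theorem polarization (a b : A) :
    star a * b = (1 / 4 : ℂ) • (star (a + b) * (a + b) - star (a + (-1 : ℂ) • b) *
      (a + (-1 : ℂ) • b) - Complex.I • (star (a + Complex.I • b) * (a + Complex.I • b))
      + Complex.I • (star (a + (-Complex.I) • b) * (a + (-Complex.I) • b))) := by
  have hI : Complex.I * Complex.I = -1 := Complex.I_mul_I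
  simp only [star_add, star_smul, mul_add, add_mul, smul_mul_assoc, mul_smul_comm, star_neg,
    star_one, Complex.star_def, Complex.conj_I, smul_add, smul_sub, smul_smul]
  simp only [mul_neg, neg_mul, neg_neg, mul_one, hI]
  match_scalars <;> ring_nf

/-- By polarization the products a*b are combinations of squares c*c with c again in 𝒩_ψ, so the
squares determine a linear functional. -/
theorem linearMap_ext_NstarN {ψ : A → ℝ≥0∞} (hadd : ∀ a ∈ N ψ, ∀ b ∈ N ψ, a + b ∈ N ψ)
    (hsmul : ∀ (z : ℂ), ∀ a ∈ N ψ, z • a ∈ N ψ) {L L' : NstarN ψ →ₗ[ℂ] ℂ}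
    (h : ∀ a (ha : a ∈ N ψ), L ⟨star a * a, Submodule.subset_span ⟨a, ha, a, ha, rfl⟩⟩ =
      L' ⟨star a * a, Submodule.subset_span ⟨a, ha, a, ha, rfl⟩⟩) : L = L' := by
  refine LinearMap.ext ?_
  rintro ⟨x, hx⟩
  refine Submodule.span_induction (p := fun x hx => L ⟨x, hx⟩ = L' ⟨x, hx⟩) ?_ ?_ ?_ ?_ hx
  · rintro _ ⟨a, ha, b, hb, rfl⟩
    have hm : ∀ z : ℂ, a + z • b ∈ N ψ := fun z => hadd a ha _ (hsmul z b hb)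
    let q : ∀ c, c ∈ N ψ → NstarN ψ := fun c hc =>
      ⟨star c * c, Submodule.subset_span ⟨c, hc, c, hc, rfl⟩⟩
    have e : (⟨star a * b, Submodule.subset_span ⟨a, ha, b, hb, rfl⟩⟩ : NstarN ψ) =
        (1 / 4 : ℂ) • (q (a + b) (hadd a ha b hb) - q _ (hm (-1)) - Complex.I • q _ (hm Complex.I)
          + Complex.I • q _ (hm (-Complex.I))) :=
      Subtype.ext (polarization a b)
    have hq : ∀ c hc, L (q c hc) = L' (q c hc) := h
    rw [e]
    simp only [map_smul, map_add, map_sub, hq]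
  · exact (map_zero L).trans (map_zero L').symm
  · intro x y hx hy h1 h2
    have e : (⟨x + y, add_mem hx hy⟩ : NstarN ψ) = ⟨x, hx⟩ + ⟨y, hy⟩ := rfl
    rw [e, map_add, map_add, h1, h2]
  · intro z x hx h1
    have e : (⟨z • x, Submodule.smul_mem _ z hx⟩ : NstarN ψ) = z • ⟨x, hx⟩ := rfl
    rw [e, map_smul, map_smul, h1]

/-- `linExt` is an arbitrary choice among the extensions. Any candidate that is correct on positive
elements proves that the choice is not void, and by uniqueness equals it. -/
theorem ext_eq_of_linearMap {ψ : A → ℝ≥0∞} (hadd : ∀ a ∈ N ψ, ∀ b ∈ N ψ, a + b ∈ N ψ)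
    (hsmul : ∀ (z : ℂ), ∀ a ∈ N ψ, z • a ∈ N ψ) (L : NstarN ψ →ₗ[ℂ] ℂ)
    (hL : ∀ x : NstarN ψ, (x : A) ∈ posCone A → ψ x < ∞ ∧ L x = ((ψ x).toReal : ℂ))
    {x : A} (hx : x ∈ NstarN ψ) : ext ψ x = L ⟨x, hx⟩ := by
  have hex : ∃ L : NstarN ψ →ₗ[ℂ] ℂ, ∀ x : NstarN ψ, (x : A) ∈ posCone A →
      ψ x < ∞ ∧ L x = ((ψ x).toReal : ℂ) := ⟨L, hL⟩
  have e : linExt ψ = L := by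
    rw [linExt, dif_pos hex]
    refine linearMap_ext_NstarN hadd hsmul fun a ha => ?_
    rw [(hex.choose_spec _ ⟨a, rfl⟩).2, (hL _ ⟨a, rfl⟩).2]
  rw [ext, dif_pos hx, e]

end CStarWeight

/-! ### The weight of a measure as an L² norm on G -/

namespace EtaleGroupoid

open CStarWeight

variable {G X : Type*} [TopologicalSpace G] [TopologicalSpace X] (𝒢 : EtaleGroupoid G X)

theorem exists_condExp_eq_ofReal {a : 𝒢.CstarR} (ha : a ∈ posCone 𝒢.CstarR) (x : X) :
    ∃ t : ℝ, 0 ≤ t ∧ 𝒢.condExp a x = t := by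
  obtain ⟨b, rfl⟩ := ha
  exact ⟨_, by positivity, 𝒢.condExp_star_mul_self b x⟩

theorem mul_mem_NstarN [MeasurableSpace X] (m : Measure X) {a b : 𝒢.CstarR}
    (ha : star a ∈ N (𝒢.weight m)) (hb : b ∈ N (𝒢.weight m)) : a * b ∈ NstarN (𝒢.weight m) :=
  Submodule.subset_span ⟨star a, ha, b, hb, by rw [star_star]⟩

variable [T2Space G] [SecondCountableTopology G] [T2Space X]
  [MeasurableSpace G] [BorelSpace G] [MeasurableSpace X] [BorelSpace X] (m : Measure X)

/-- The measure `∫ ∑_{s(g) = x} δ_g dm(x)`. -/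
noncomputable def sMeasure : Measure G := fiberMeasure 𝒢.s 𝒢.isLocalHomeomorph_s m

/-- The measure `∫ ∑_{r(g) = x} δ_g dm(x)`. -/
noncomputable def rMeasure : Measure G := fiberMeasure 𝒢.r 𝒢.isLocalHomeomorph_r m

theorem map_inv_sMeasure : (𝒢.sMeasure m).map 𝒢.inv = 𝒢.rMeasure m := by
  have hinv : Measurable 𝒢.inv := 𝒢.continuous_inv.measurable
  refine Measure.ext_of_lintegral _ fun u hu => ?_
  rw [lintegral_map hu hinv, sMeasure, rMeasure,
    lintegral_fiberMeasure (u := fun g => u (𝒢.inv g)) _ _ (hu.comp hinv),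
    lintegral_fiberMeasure _ _ hu]
  refine lintegral_congr fun x => ?_
  let e : {g : G // 𝒢.s g = x} ≃ {g : G // 𝒢.r g = x} :=
    { toFun := fun g => ⟨𝒢.inv g, (𝒢.r_inv g).trans g.2⟩
      invFun := fun g => ⟨𝒢.inv g, (𝒢.s_inv g).trans g.2⟩
      left_inv := fun g => Subtype.ext (𝒢.inv_inv g)
      right_inv := fun g => Subtype.ext (𝒢.inv_inv g) }
  exact e.tsum_eq fun g => u g

theorem measurePreserving_inv : MeasurePreserving 𝒢.inv (𝒢.rMeasure m) (𝒢.sMeasure m) := by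
  refine ⟨𝒢.continuous_inv.measurable, ?_⟩
  rw [← map_inv_sMeasure, Measure.map_map 𝒢.continuous_inv.measurable 𝒢.continuous_inv.measurable]
  have : 𝒢.inv ∘ 𝒢.inv = id := funext 𝒢.inv_inv
  rw [this, Measure.map_id]

/-- The fibres of `s` meet `K` in at most `n` points and only over the compact set `s '' K`, which
gives the bound `n * m (𝒢.s '' K)`. -/
theorem sMeasure_lt_top_of_isCompact [IsFiniteMeasureOnCompacts m] {K : Set G}
    (hK : IsCompact K) : 𝒢.sMeasure m K < ∞ := by
  obtain ⟨n, hn⟩ := exists_fiber_bound 𝒢.isLocalHomeomorph_s hK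
  have hsK : IsCompact (𝒢.s '' K) := hK.image 𝒢.continuous_s
  rw [← lintegral_indicator_one hK.measurableSet, sMeasure,
    lintegral_fiberMeasure _ _ (measurable_one.indicator hK.measurableSet)]
  calc _ ≤ ∫⁻ x, (𝒢.s '' K).indicator (fun _ => (n : ℝ≥0∞)) x ∂m := by
        refine lintegral_mono fun x => ?_
        by_cases hx : x ∈ 𝒢.s '' K
        · rw [indicator_of_mem hx]
          refine (tsum_indicator_le (hn x) 1).trans (by rw [mul_one])
        · rw [indicator_of_notMem hx]
          refine le_of_eq ((tsum_congr fun g => ?_).trans tsum_zero)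
          refine indicator_of_notMem (fun hg => hx ?_) _
          rw [← g.2]
          exact mem_image_of_mem _ hg
    _ = n * m (𝒢.s '' K) := lintegral_indicator_const hsK.measurableSet _
    _ < ∞ := ENNReal.mul_lt_top (by simp) hsK.measure_lt_top

instance [IsFiniteMeasureOnCompacts m] : IsFiniteMeasureOnCompacts (𝒢.sMeasure m) :=
  ⟨fun _ hK => 𝒢.sMeasure_lt_top_of_isCompact m hK⟩

instance [IsFiniteMeasureOnCompacts m] : IsFiniteMeasureOnCompacts (𝒢.rMeasure m) := by
  refine ⟨fun K hK => ?_⟩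
  rw [← map_inv_sMeasure, Measure.map_apply 𝒢.continuous_inv.measurable hK.measurableSet]
  have : 𝒢.inv ⁻¹' K = 𝒢.inv '' K := by
    ext g
    exact ⟨fun h => ⟨_, h, 𝒢.inv_inv g⟩, by rintro ⟨k, hk, rfl⟩; rwa [mem_preimage, 𝒢.inv_inv]⟩
  rw [this]
  exact (hK.image 𝒢.continuous_inv).measure_lt_top

variable [LocallyCompactSpace G]

theorem weight_star_mul_self (a : 𝒢.CstarR) :
    𝒢.weight m (star a * a) = ∫⁻ g, ‖𝒢.coeff a g‖ₑ ^ 2 ∂(𝒢.sMeasure m) := by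
  rw [sMeasure, lintegral_fiberMeasure]
  · exact lintegral_congr fun x => 𝒢.ofReal_condExp_star_mul_self a x
  · exact (𝒢.continuous_coeff a).measurable.enorm.pow_const 2

theorem mem_N_weight_iff (a : 𝒢.CstarR) :
    a ∈ N (𝒢.weight m) ↔ MemLp (𝒢.coeff a) 2 (𝒢.sMeasure m) := by
  have hm := (𝒢.continuous_coeff a).measurable.aestronglyMeasurable (μ := 𝒢.sMeasure m)
  rw [MemLp, and_iff_right hm, eLpNorm_lt_top_iff_lintegral_rpow_enorm_lt_top (by simp) (by simp)]
  simp only [ENNReal.toReal_ofNat, ENNReal.rpow_ofNat]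
  rw [← weight_star_mul_self]
  rfl

theorem add_mem_N_weight {a b : 𝒢.CstarR} (ha : a ∈ N (𝒢.weight m)) (hb : b ∈ N (𝒢.weight m)) :
    a + b ∈ N (𝒢.weight m) := by
  rw [mem_N_weight_iff] at *
  rw [map_add]
  exact ha.add hb

set_option synthInstance.maxHeartbeats 200000 in
theorem smul_mem_N_weight (z : ℂ) {a : 𝒢.CstarR} (ha : a ∈ N (𝒢.weight m)) :
    z • a ∈ N (𝒢.weight m) := by
  rw [mem_N_weight_iff] at *
  rw [map_smul]
  exact ha.const_smul z

theorem integrable_star_coeff_mul {a b : 𝒢.CstarR} (ha : a ∈ N (𝒢.weight m))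
    (hb : b ∈ N (𝒢.weight m)) :
    Integrable (fun g => star (𝒢.coeff a g) * 𝒢.coeff b g) (𝒢.sMeasure m) := by
  rw [mem_N_weight_iff] at *
  exact MemLp.integrable_mul ha.star hb

theorem condExp_star_mul_integral {a b : 𝒢.CstarR} (ha : a ∈ N (𝒢.weight m))
    (hb : b ∈ N (𝒢.weight m)) :
    Integrable (𝒢.condExp (star a * b)) m ∧ ∫ x, 𝒢.condExp (star a * b) x ∂m =
      ∫ g, star (𝒢.coeff a g) * 𝒢.coeff b g ∂(𝒢.sMeasure m) := by
  have h := integral_fiberMeasure 𝒢.isLocalHomeomorph_s m (𝒢.integrable_star_coeff_mul m ha hb)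
  have e : (fun x => ∑' g : {g : G // 𝒢.s g = x}, star (𝒢.coeff a g) * 𝒢.coeff b g) =
      𝒢.condExp (star a * b) := funext fun x => (𝒢.hasSum_condExp_star_mul a b x).tsum_eq
  rw [e] at h
  exact ⟨h.1, h.2.symm⟩

theorem integrable_condExp {x : 𝒢.CstarR} (hx : x ∈ NstarN (𝒢.weight m)) :
    Integrable (𝒢.condExp x) m := by
  refine Submodule.span_induction ?_ ?_ ?_ ?_ hx
  · rintro _ ⟨a, ha, b, hb, rfl⟩
    exact (𝒢.condExp_star_mul_integral m ha hb).1
  · rw [map_zero]; exact integrable_zero _ _ _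
  · intro x y _ _ hx hy
    rw [map_add]; exact hx.add hy
  · intro z x _ hx
    rw [map_smul]; exact hx.smul z

/-- Integration of `condExp` is linear on 𝒩*𝒩 because every element there has integrable
expectation. On positive elements the expectation is non-negative, so the Bochner integral is the
value of the weight. -/
theorem ext_weight {x : 𝒢.CstarR} (hx : x ∈ NstarN (𝒢.weight m)) :
    CStarWeight.ext (𝒢.weight m) x = ∫ y, 𝒢.condExp x y ∂m := by
  let L : NstarN (𝒢.weight m) →ₗ[ℂ] ℂ :=
    { toFun := fun x => ∫ y, 𝒢.condExp x y ∂m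
      map_add' := fun a b => by
        simp only [Submodule.coe_add, map_add, Pi.add_apply]
        exact integral_add (𝒢.integrable_condExp m a.2) (𝒢.integrable_condExp m b.2)
      map_smul' := fun z a => by
        simp only [Submodule.coe_smul, map_smul, Pi.smul_apply, RingHom.id_apply]
        exact integral_smul z _ }
  refine ext_eq_of_linearMap (fun a ha b hb => 𝒢.add_mem_N_weight m ha hb)
    (fun z a ha => 𝒢.smul_mem_N_weight m z ha) L ?_ hx
  intro a ha
  have hi := 𝒢.integrable_condExp m a.2
  have hre : ∀ y, 𝒢.condExp a y = ((𝒢.condExp a y).re : ℂ) ∧ 0 ≤ (𝒢.condExp a y).re := by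
    intro y
    obtain ⟨t, ht, h⟩ := 𝒢.exists_condExp_eq_ofReal ha y
    rw [h]
    exact ⟨by simp, by simpa using ht⟩
  have h1 := (ofReal_integral_eq_lintegral_ofReal hi.re (ae_of_all _ fun y => (hre y).2))
  refine ⟨?_, ?_⟩
  · exact lt_of_eq_of_lt h1.symm ENNReal.ofReal_lt_top
  · change ∫ y, 𝒢.condExp a y ∂m = ((∫⁻ y, ENNReal.ofReal (𝒢.condExp a y).re ∂m).toReal : ℂ)
    have h2 : (∫⁻ y, ENNReal.ofReal (𝒢.condExp a y).re ∂m).toReal =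
        ∫ y, (𝒢.condExp a y).re ∂m := by
      rw [← ENNReal.toReal_ofReal (integral_nonneg fun y => (hre y).2)]
      exact congrArg _ h1.symm
    rw [h2, ← integral_complex_ofReal]
    exact integral_congr_ae (ae_of_all _ fun y => (hre y).1)

/-- This is the L²(μ_s) inner product of a* and b, with the conjugate of a*(g) equal to a(g⁻¹). -/
theorem ext_weight_mul {a b : 𝒢.CstarR} (ha : star a ∈ N (𝒢.weight m))
    (hb : b ∈ N (𝒢.weight m)) :
    CStarWeight.ext (𝒢.weight m) (a * b) =
      ∫ g, 𝒢.coeff a (𝒢.inv g) * 𝒢.coeff b g ∂(𝒢.sMeasure m) := by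
  rw [𝒢.ext_weight m (𝒢.mul_mem_NstarN m ha hb)]
  have := (𝒢.condExp_star_mul_integral m ha hb).2
  simpa only [star_star, coeff_star] using this

theorem integrable_coeff_mul {a b : 𝒢.CstarR} (ha : star a ∈ N (𝒢.weight m))
    (hb : b ∈ N (𝒢.weight m)) :
    Integrable (fun g => 𝒢.coeff a (𝒢.inv g) * 𝒢.coeff b g) (𝒢.sMeasure m) := by
  have := 𝒢.integrable_star_coeff_mul m ha hb
  simpa only [star_star, coeff_star] using this

theorem toCstarR_mem_N [IsFiniteMeasureOnCompacts m] (f : C_c(G, ℂ)) :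
    𝒢.toCstarR f ∈ N (𝒢.weight m) := by
  rw [mem_N_weight_iff]
  have : 𝒢.coeff (𝒢.toCstarR f) = f := funext fun g => 𝒢.coeff_toCstarR f g
  rw [this]
  exact f.continuous.memLp_of_hasCompactSupport f.hasCompactSupport

theorem star_toCstarR_mem_N [IsFiniteMeasureOnCompacts m] (f : C_c(G, ℂ)) :
    star (𝒢.toCstarR f) ∈ N (𝒢.weight m) := by
  rw [← toCstarR_ccStar]
  exact 𝒢.toCstarR_mem_N m _

end EtaleGroupoid

/-! ### Conformality as an identity between the two fibre measures -/

namespace EtaleGroupoid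

open CStarWeight

variable {G X : Type*} [TopologicalSpace G] [TopologicalSpace X] {𝒢 : EtaleGroupoid G X}

theorem IsOpenBisection.inter {W W' : Set G} (hW : 𝒢.IsOpenBisection W)
    (hW' : 𝒢.IsOpenBisection W') : 𝒢.IsOpenBisection (W ∩ W') :=
  ⟨hW.isOpen.inter hW'.isOpen, hW.injOn_r.mono inter_subset_left,
    hW.injOn_s.mono inter_subset_left⟩

theorem exists_isOpenBisection_subset (𝒢 : EtaleGroupoid G X) {U : Set G} {g : G} (hg : g ∈ U)
    (hU : IsOpen U) :
    ∃ W, 𝒢.IsOpenBisection W ∧ g ∈ W ∧ W ⊆ U := by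
  obtain ⟨e, he, hre⟩ := 𝒢.isLocalHomeomorph_r g
  obtain ⟨e', he', hse⟩ := 𝒢.isLocalHomeomorph_s g
  refine ⟨e.source ∩ e'.source ∩ U, ⟨(e.open_source.inter e'.open_source).inter hU, ?_, ?_⟩,
    ⟨⟨he, he'⟩, hg⟩, inter_subset_right⟩
  · rw [hre]; exact e.injOn.mono fun h hh => hh.1.1
  · rw [hse]; exact e'.injOn.mono fun h hh => hh.1.2

theorem isTopologicalBasis_isOpenBisection (𝒢 : EtaleGroupoid G X) :
    TopologicalSpace.IsTopologicalBasis {W | 𝒢.IsOpenBisection W} :=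
  TopologicalSpace.isTopologicalBasis_of_isOpen_of_nhds (fun _ h => h.isOpen) fun _ _ hg hU =>
    (𝒢.exists_isOpenBisection_subset hg hU).imp fun _ h => ⟨h.1, h.2⟩

theorem IsOpenBisection.rInv_eq {W : Set G} (hW : 𝒢.IsOpenBisection W) {g : G} (hg : g ∈ W)
    (x : 𝒢.r '' W) (hx : 𝒢.r g = x) : (hW.rInv x : G) = g := by
  have h := (Equiv.Set.imageOfInjOn 𝒢.r W hW.injOn_r).apply_symm_apply x
  refine hW.injOn_r (hW.rInv x).2 hg ?_
  rw [hx]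
  exact congrArg Subtype.val h

theorem ContHom.measurable_density [MeasurableSpace G] [BorelSpace G] (c : 𝒢.ContHom)
    (β : ℝ) :
    Measurable fun g => ENNReal.ofReal (Real.exp (β * c.toFun g)) := by
  have := c.continuous_toFun.measurable
  fun_prop

theorem twist_I_mul_apply (c : 𝒢.ContHom) (β : ℝ) (f : C_c(G, ℂ)) (g : G) :
    c.twist (Complex.I * β) f g = (Real.exp (-β * c.toFun g) : ℂ) * f g := by
  rw [ContHom.twist_apply, ← _root_.mul_assoc, Complex.I_mul_I, Complex.ofReal_exp]
  push_cast
  ring_nf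

variable [T2Space G] [SecondCountableTopology G] [T2Space X]
  [MeasurableSpace G] [BorelSpace G] [MeasurableSpace X] [BorelSpace X] (c : 𝒢.ContHom) (β : ℝ)
  (m : Measure X)

/-- The fibre of `r` over a point of `r '' W` meets `W` in exactly one point, the value of
`hW.rInv`, so the fibre sum of `W.indicator u` has a single term. -/
theorem IsOpenBisection.lintegral_rInv {W : Set G} (hW : 𝒢.IsOpenBisection W) {u : G → ℝ≥0∞}
    (hu : Measurable u) :
    ∫⁻ x : 𝒢.r '' W, u (hW.rInv x) ∂(m.comap Subtype.val) = ∫⁻ g in W, u g ∂(𝒢.rMeasure m) := by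
  have hWm : MeasurableSet W := hW.isOpen.measurableSet
  have hrW : MeasurableSet (𝒢.r '' W) :=
    (𝒢.isLocalHomeomorph_r.isOpenMap _ hW.isOpen).measurableSet
  set φ : X → ℝ≥0∞ := fun x => ∑' g : {g : G // 𝒢.r g = x}, W.indicator u g with hφ
  have h1 : ∀ x : 𝒢.r '' W, u (hW.rInv x) = φ x := by
    intro x
    have hr : 𝒢.r (hW.rInv x) = x := by
      obtain ⟨g, hg, hx⟩ := x.2
      rw [hW.rInv_eq hg x hx, hx]
    let g₀ : {g : G // 𝒢.r g = x} := ⟨hW.rInv x, hr⟩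
    rw [hφ]
    refine Eq.trans ?_ (tsum_eq_single g₀ ?_).symm
    · exact (indicator_of_mem (hW.rInv x).2 u).symm
    · intro g hg
      refine indicator_of_notMem (fun hgW => hg (Subtype.ext ?_)) _
      exact (hW.rInv_eq hgW x g.2).symm
  have h2 : ∀ x, x ∉ 𝒢.r '' W → φ x = 0 := by
    intro x hx
    refine (tsum_congr fun g => ?_).trans tsum_zero
    refine indicator_of_notMem (fun hgW => hx ?_) _
    rw [← g.2]
    exact mem_image_of_mem _ hgW
  simp_rw [h1]
  rw [lintegral_subtype_comap hrW φ, ← lintegral_indicator hrW, ← lintegral_indicator hWm,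
    rMeasure, lintegral_fiberMeasure _ _ (hu.indicator hWm)]
  refine lintegral_congr fun x => ?_
  by_cases hx : x ∈ 𝒢.r '' W
  · rw [indicator_of_mem hx]
  · rw [indicator_of_notMem hx]
    exact (h2 x hx).symm

theorem IsOpenBisection.sMeasure_apply {W : Set G} (hW : 𝒢.IsOpenBisection W) :
    𝒢.sMeasure m W = m (𝒢.s '' W) :=
  fiberMeasure_apply_of_injOn _ m hW.isOpen.measurableSet hW.injOn_s
    (𝒢.isLocalHomeomorph_s.isOpenMap _ hW.isOpen).measurableSet

/-- Conformality is the equality of measures tested on open bisections. These form a π-system and a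
basis of the topology. Relatively compact ones have finite measure and countably many of them cover
`G`, so the uniqueness theorem for measures applies. -/
theorem isConformal_iff_sMeasure_eq [LocallyCompactSpace G] [IsFiniteMeasureOnCompacts m] :
    IsConformal c β m ↔ 𝒢.sMeasure m = (𝒢.rMeasure m).withDensity
      fun g => ENNReal.ofReal (Real.exp (β * c.toFun g)) := by
  have hd := c.measurable_density β
  have key : IsConformal c β m ↔ ∀ W ∈ {W | 𝒢.IsOpenBisection W}, 𝒢.sMeasure m W =
      (𝒢.rMeasure m).withDensity (fun g => ENNReal.ofReal (Real.exp (β * c.toFun g))) W := by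
    refine forall₂_congr fun W hW => ?_
    rw [IsOpenBisection.sMeasure_apply m hW, withDensity_apply _ hW.isOpen.measurableSet,
      ← IsOpenBisection.lintegral_rInv m hW hd]
  rw [key]
  refine ⟨fun h => ?_, fun h W _ => by rw [h]⟩
  have hcov : ∀ g : G, ∃ W, 𝒢.IsOpenBisection W ∧ W ∈ 𝓝 g ∧ 𝒢.sMeasure m W ≠ ∞ := by
    intro g
    obtain ⟨K, hK, hgK⟩ := exists_compact_mem_nhds g
    obtain ⟨W, hW, hgW, hWK⟩ := 𝒢.exists_isOpenBisection_subset
      (mem_interior_iff_mem_nhds.2 hgK) isOpen_interior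
    refine ⟨W, hW, hW.isOpen.mem_nhds hgW, ne_of_lt ?_⟩
    exact (measure_mono (hWK.trans interior_subset)).trans_lt hK.measure_lt_top
  choose W hW hgW hWm using hcov
  obtain ⟨t, ht, htW⟩ := TopologicalSpace.countable_cover_nhds hgW
  refine Measure.ext_of_generateFrom_of_cover_subset (T := W '' t)
    (BorelSpace.measurable_eq.trans 𝒢.isTopologicalBasis_isOpenBisection.borel_eq_generateFrom)
    ?_ ?_ (ht.image W) ?_ ?_ h
  · intro W hW W' hW' _
    exact IsOpenBisection.inter hW hW'
  · rintro _ ⟨g, -, rfl⟩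
    exact hW g
  · rw [sUnion_image, htW]
  · rintro _ ⟨g, -, rfl⟩
    exact hWm g

theorem sMeasure_eq_iff_rMeasure_eq :
    (𝒢.sMeasure m = (𝒢.rMeasure m).withDensity
      fun g => ENNReal.ofReal (Real.exp (β * c.toFun g))) ↔
    𝒢.rMeasure m = (𝒢.sMeasure m).withDensity
      fun g => ENNReal.ofReal (Real.exp (-β * c.toFun g)) := by
  have key : ∀ (γ : ℝ) (μ : Measure G),
      (μ.withDensity fun g => ENNReal.ofReal (Real.exp (γ * c.toFun g))).withDensity
        (fun g => ENNReal.ofReal (Real.exp (-γ * c.toFun g))) = μ := by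
    intro γ μ
    rw [← withDensity_mul _ (c.measurable_density γ) (c.measurable_density (-γ))]
    have : ((fun g => ENNReal.ofReal (Real.exp (γ * c.toFun g))) *
        fun g => ENNReal.ofReal (Real.exp (-γ * c.toFun g))) = 1 := by
      funext g
      rw [Pi.mul_apply, ← ENNReal.ofReal_mul (Real.exp_pos _).le, ← Real.exp_add]
      simp
    rw [this, withDensity_one]
  constructor
  · intro h
    rw [h, key]
  · intro h
    have := key (-β) (𝒢.sMeasure m)
    rw [← h, neg_neg] at this
    exact this.symm

theorem integral_rMeasure_eq_integral_inv (u : G → ℂ) :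
    ∫ g, u (𝒢.inv g) ∂(𝒢.rMeasure m) = ∫ g, u g ∂(𝒢.sMeasure m) := by
  let e : G ≃ₜ G :=
    { toFun := 𝒢.inv, invFun := 𝒢.inv, left_inv := 𝒢.inv_inv, right_inv := 𝒢.inv_inv,
      continuous_toFun := 𝒢.continuous_inv, continuous_invFun := 𝒢.continuous_inv }
  exact (𝒢.measurePreserving_inv m).integral_comp e.measurableEmbedding u

theorem integral_rMeasure_eq (h : 𝒢.rMeasure m = (𝒢.sMeasure m).withDensity
      fun g => ENNReal.ofReal (Real.exp (-β * c.toFun g))) (u : G → ℂ) :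
    ∫ g, u g ∂(𝒢.rMeasure m) =
      ∫ g, (Real.exp (-β * c.toFun g) : ℂ) * u g ∂(𝒢.sMeasure m) := by
  rw [h, integral_withDensity_eq_integral_toReal_smul (c.measurable_density (-β))
    (ae_of_all _ fun _ => ENNReal.ofReal_lt_top)]
  refine integral_congr_ae (ae_of_all _ fun g => ?_)
  simp only [ENNReal.toReal_ofReal (Real.exp_pos _).le, Complex.real_smul]

variable [LocallyCompactSpace G]

theorem ext_weight_toCstarR_mul [IsFiniteMeasureOnCompacts m] (f g : C_c(G, ℂ)) :
    CStarWeight.ext (𝒢.weight m) (𝒢.toCstarR f * 𝒢.toCstarR g) =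
      ∫ h, f (𝒢.inv h) * g h ∂(𝒢.sMeasure m) := by
  rw [𝒢.ext_weight_mul m (𝒢.star_toCstarR_mem_N m f) (𝒢.toCstarR_mem_N m g)]
  simp_rw [coeff_toCstarR]

/-- Both sides of the identity integrate the function f(h) g(h⁻¹), one against μ_r and the other
against e^{-βc} μ_s. Every compactly supported continuous function has this form, and such functions
determine the two measures. -/
theorem rMeasure_eq_iff_ext_weight [IsFiniteMeasureOnCompacts m] :
    (𝒢.rMeasure m = (𝒢.sMeasure m).withDensity
      fun g => ENNReal.ofReal (Real.exp (-β * c.toFun g))) ↔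
    ∀ f g : C_c(G, ℂ), CStarWeight.ext (𝒢.weight m) (𝒢.toCstarR f * 𝒢.toCstarR g) =
      CStarWeight.ext (𝒢.weight m)
        (𝒢.toCstarR g * 𝒢.toCstarR (c.twist (Complex.I * β) f)) := by
  have hl : ∀ f g : C_c(G, ℂ), CStarWeight.ext (𝒢.weight m) (𝒢.toCstarR f * 𝒢.toCstarR g) =
      ∫ h, f h * g (𝒢.inv h) ∂(𝒢.rMeasure m) := by
    intro f g
    rw [ext_weight_toCstarR_mul, ← integral_rMeasure_eq_integral_inv]
    simp_rw [inv_inv]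
  have hr : ∀ f g : C_c(G, ℂ), CStarWeight.ext (𝒢.weight m)
        (𝒢.toCstarR g * 𝒢.toCstarR (c.twist (Complex.I * β) f)) =
      ∫ h, (Real.exp (-β * c.toFun h) : ℂ) * (f h * g (𝒢.inv h)) ∂(𝒢.sMeasure m) := by
    intro f g
    rw [ext_weight_toCstarR_mul]
    refine integral_congr_ae (ae_of_all _ fun h => ?_)
    simp only [twist_I_mul_apply]
    ring
  simp_rw [hr, hl]
  constructor
  · intro h f g
    exact integral_rMeasure_eq c β m h _
  · intro h
    -- Determining a measure by its integrals over compactly supported functions requires local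
    -- finiteness, which holds here because the density is continuous.
    have hlf : IsLocallyFiniteMeasure ((𝒢.sMeasure m).withDensity
        fun g => ENNReal.ofReal (Real.exp (-β * c.toFun g))) := by
      refine IsLocallyFiniteMeasure.withDensity_ofReal ?_
      have := c.continuous_toFun
      fun_prop
    refine Measure.ext_of_integral_eq_on_compactlySupported fun F => ?_
    -- The cut-off equals 1 on the inverse of the support of `F`, so that F(h) χ(h⁻¹) = F(h) for all
    -- h.
    obtain ⟨χ, hχ1, -, hχc, -⟩ := exists_continuous_one_zero_of_isCompact
      (F.hasCompactSupport.isCompact.image 𝒢.continuous_inv) isClosed_empty (disjoint_empty _)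
    let f : C_c(G, ℂ) :=
      { toFun := fun g => (F g : ℂ)
        continuous_toFun := Complex.continuous_ofReal.comp F.continuous
        hasCompactSupport' := F.hasCompactSupport.comp_left (g := Complex.ofReal)
          Complex.ofReal_zero }
    let g : C_c(G, ℂ) :=
      { toFun := fun g => (χ g : ℂ)
        continuous_toFun := Complex.continuous_ofReal.comp χ.continuous
        hasCompactSupport' := hχc.comp_left (g := Complex.ofReal) Complex.ofReal_zero }
    have hfg : ∀ h, f h * g (𝒢.inv h) = F h := by
      intro h
      change (F h : ℂ) * (χ (𝒢.inv h) : ℂ) = F h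
      by_cases hh : h ∈ tsupport F
      · rw [hχ1 (mem_image_of_mem _ hh), Pi.one_apply, Complex.ofReal_one, mul_one]
      · rw [image_eq_zero_of_notMem_tsupport hh, Complex.ofReal_zero, zero_mul]
    have := h f g
    simp_rw [hfg, ← Complex.ofReal_mul] at this
    rw [integral_complex_ofReal, integral_complex_ofReal, Complex.ofReal_inj] at this
    rw [this, integral_withDensity_eq_integral_toReal_smul (c.measurable_density (-β))
      (ae_of_all _ fun _ => ENNReal.ofReal_lt_top)]
    refine integral_congr_ae (ae_of_all _ fun g => ?_)
    simp only [ENNReal.toReal_ofReal (Real.exp_pos _).le, smul_eq_mul]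

end EtaleGroupoid

/-! ### Fourier–Laplace integrals and uniqueness on the strip -/

namespace CStarWeight

/-- The exponent lies between 0 and -βt, so the exponential is at most the larger of its two edge
values, and hence at most their sum. -/
theorem exp_mul_le_of_mem_uIcc {β y : ℝ} (hy : y ∈ Set.uIcc 0 β) (t : ℝ) :
    Real.exp (-y * t) ≤ 1 + Real.exp (-β * t) := by
  have key : -y * t ≤ 0 ∨ -y * t ≤ -β * t := by
    rcases Set.mem_uIcc.1 hy with ⟨h0, h1⟩ | ⟨h0, h1⟩ <;> rcases le_total 0 t with ht | ht
    · left; nlinarith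
    · right; nlinarith
    · right; nlinarith
    · left; nlinarith
  rcases key with h | h
  · have := Real.exp_le_one_iff.2 h
    have := Real.exp_pos (-β * t)
    linarith
  · have := Real.exp_le_exp.2 h
    linarith

theorem norm_exp_I_mul (z : ℂ) (t : ℝ) :
    ‖Complex.exp (Complex.I * z * t)‖ = Real.exp (-z.im * t) := by
  rw [Complex.norm_exp]
  simp

theorem norm_exp_I_mul_le {β : ℝ} {z : ℂ} (hz : z ∈ strip β) (t : ℝ) :
    ‖Complex.exp (Complex.I * z * t)‖ ≤ 1 + Real.exp (-β * t) := by
  rw [norm_exp_I_mul]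
  exact exp_mul_le_of_mem_uIcc hz t

section FourierLaplace

variable {α : Type*} [MeasurableSpace α] {μ : Measure α} {w : α → ℂ} {c : α → ℝ} {β : ℝ}

theorem continuousOn_integral_exp (hc : Measurable c) (hw : Integrable w μ)
    (hw' : Integrable (fun x => (Real.exp (-β * c x) : ℂ) * w x) μ) :
    ContinuousOn (fun z : ℂ => ∫ x, Complex.exp (Complex.I * z * c x) * w x ∂μ) (strip β) := by
  refine continuousOn_of_dominated (bound := fun x => ‖w x‖ + ‖(Real.exp (-β * c x) : ℂ) * w x‖)
    ?_ ?_ (hw.norm.add hw'.norm) ?_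
  · intro z _
    exact AEStronglyMeasurable.mul (by fun_prop) hw.aestronglyMeasurable
  · refine fun z hz => ae_of_all _ fun x => ?_
    rw [norm_mul, norm_mul, Complex.norm_of_nonneg (Real.exp_pos _).le]
    have := mul_le_mul_of_nonneg_right (norm_exp_I_mul_le hz (c x)) (norm_nonneg (w x))
    linarith
  · exact ae_of_all _ fun x => by fun_prop

theorem norm_integral_exp_le (hw : Integrable w μ)
    (hw' : Integrable (fun x => (Real.exp (-β * c x) : ℂ) * w x) μ) {z : ℂ} (hz : z ∈ strip β) :
    ‖∫ x, Complex.exp (Complex.I * z * c x) * w x ∂μ‖ ≤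
      ∫ x, ‖w x‖ + ‖(Real.exp (-β * c x) : ℂ) * w x‖ ∂μ := by
  refine norm_integral_le_of_norm_le (hw.norm.add hw'.norm) (ae_of_all _ fun x => ?_)
  rw [norm_mul, norm_mul, Complex.norm_of_nonneg (Real.exp_pos _).le]
  have := mul_le_mul_of_nonneg_right (norm_exp_I_mul_le hz (c x)) (norm_nonneg (w x))
  linarith

/-- Since ε|t| ≤ e^{εt} + e^{-εt}, a linear factor can be absorbed by moving the exponent up and
down by ε. It controls the factor `c x` produced by differentiation. -/
theorem abs_mul_exp_le {ε : ℝ} (hε : 0 < ε) (y t : ℝ) :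
    |t| * Real.exp (-y * t) ≤ ε⁻¹ * (Real.exp (-(y - ε) * t) + Real.exp (-(y + ε) * t)) := by
  have h1 : |t| ≤ ε⁻¹ * (Real.exp (ε * t) + Real.exp (-(ε * t))) := by
    rw [← div_eq_inv_mul, le_div_iff₀ hε]
    have h2 := Real.add_one_le_exp (ε * t)
    have h3 := Real.add_one_le_exp (-(ε * t))
    have h4 := Real.exp_pos (ε * t)
    have h5 := Real.exp_pos (-(ε * t))
    rcases abs_cases t with ⟨h, -⟩ | ⟨h, -⟩ <;> rw [h] <;> linarith
  calc |t| * Real.exp (-y * t)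
      ≤ ε⁻¹ * (Real.exp (ε * t) + Real.exp (-(ε * t))) * Real.exp (-y * t) := by gcongr
    _ = _ := by
      rw [_root_.mul_assoc, add_mul, ← Real.exp_add, ← Real.exp_add]
      ring_nf

/-- Differentiation under the integral needs no moment of `c`: at an interior point there is room to
shift the imaginary part, and `abs_mul_exp_le` trades the factor `c x` for two shifted exponentials
that still obey the strip bound. -/
theorem differentiableOn_integral_exp (hc : Measurable c) (hw : Integrable w μ)
    (hw' : Integrable (fun x => (Real.exp (-β * c x) : ℂ) * w x) μ) :
    DifferentiableOn ℂ (fun z : ℂ => ∫ x, Complex.exp (Complex.I * z * c x) * w x ∂μ)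
      (interior (strip β)) := by
  intro z₀ hz₀
  obtain ⟨δ, hδ, hball⟩ := Metric.isOpen_iff.1 isOpen_interior z₀ hz₀
  -- Half of the radius is kept for the distance to `z₀` and half for the vertical shift, so shifted
  -- points remain in the strip.
  set ε := δ / 2 with hε
  have hε0 : 0 < ε := by positivity
  have hsh : ∀ z ∈ Metric.ball z₀ ε, ∀ u : ℝ, |u| ≤ ε → z.im + u ∈ Set.uIcc 0 β := by
    intro z hz u hu
    have h1 : z + u * Complex.I ∈ strip β := by
      refine interior_subset (hball ?_)
      rw [Metric.mem_ball, dist_eq_norm] at hz ⊢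
      calc ‖z + u * Complex.I - z₀‖ = ‖(z - z₀) + u * Complex.I‖ := by ring_nf
        _ ≤ ‖z - z₀‖ + ‖(u : ℂ) * Complex.I‖ := norm_add_le _ _
        _ < ε + ε := by
          refine add_lt_add_of_lt_of_le hz ?_
          rw [norm_mul, Complex.norm_I, mul_one, Complex.norm_real]
          exact hu
        _ = δ := by rw [hε]; ring
    simpa [strip] using h1
  have hmem : z₀ ∈ strip β := interior_subset hz₀
  have hmeas : ∀ z : ℂ,
      AEStronglyMeasurable (fun x => Complex.exp (Complex.I * z * c x) * w x) μ := fun z =>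
    AEStronglyMeasurable.mul (by fun_prop) hw.aestronglyMeasurable
  have hint : Integrable (fun x => Complex.exp (Complex.I * z₀ * c x) * w x) μ := by
    refine (hw.norm.add hw'.norm).mono' (hmeas z₀) (ae_of_all _ fun x => ?_)
    rw [Pi.add_apply, norm_mul, norm_mul, Complex.norm_of_nonneg (Real.exp_pos _).le]
    have := mul_le_mul_of_nonneg_right (norm_exp_I_mul_le hmem (c x)) (norm_nonneg (w x))
    linarith
  have h := hasDerivAt_integral_of_dominated_loc_of_deriv_le (𝕜 := ℂ) (μ := μ) (x₀ := z₀)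
    (s := Metric.ball z₀ ε) (F := fun z x => Complex.exp (Complex.I * z * c x) * w x)
    (F' := fun z x => (Complex.exp (Complex.I * z * c x) * (Complex.I * c x)) * w x)
    -- The factor 2 counts the two shifted exponentials, each at most 1 + e^{-βc}.
    (bound := fun x => ε⁻¹ * 2 * (‖w x‖ + ‖(Real.exp (-β * c x) : ℂ) * w x‖))
    (Metric.ball_mem_nhds z₀ hε0) (Eventually.of_forall hmeas) hint
    (AEStronglyMeasurable.mul (by fun_prop) hw.aestronglyMeasurable) ?_
    ((hw.norm.add hw'.norm).const_mul _) ?_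
  · exact h.2.differentiableAt.differentiableWithinAt
  · refine ae_of_all _ fun x z hz => ?_
    have h1 := abs_mul_exp_le hε0 z.im (c x)
    have h2 := exp_mul_le_of_mem_uIcc (hsh z hz (-ε) (by rw [abs_neg, abs_of_pos hε0])) (c x)
    have h3 := exp_mul_le_of_mem_uIcc (hsh z hz ε (by rw [abs_of_pos hε0])) (c x)
    rw [← sub_eq_add_neg] at h2
    have h4 : |c x| * Real.exp (-z.im * c x) ≤ ε⁻¹ * 2 * (1 + Real.exp (-β * c x)) := by
      refine h1.trans ?_
      rw [_root_.mul_assoc]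
      gcongr
      linarith
    have h5 := mul_le_mul_of_nonneg_right h4 (norm_nonneg (w x))
    rw [norm_mul, norm_mul, norm_mul, norm_mul, norm_exp_I_mul, Complex.norm_I, one_mul,
      Complex.norm_real, Complex.norm_of_nonneg (Real.exp_pos _).le, Real.norm_eq_abs]
    calc _ = |c x| * Real.exp (-z.im * c x) * ‖w x‖ := by ring
      _ ≤ _ := h5
      _ = _ := by ring
  · refine ae_of_all _ fun x z _ => ?_
    have h1 : HasDerivAt (fun z : ℂ => Complex.I * z * c x) (Complex.I * c x) z := by
      have := ((hasDerivAt_id z).const_mul Complex.I).mul_const (c x : ℂ)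
      simpa using this
    exact h1.cexp.mul_const (w x)

end FourierLaplace

/-- The three lines theorem with bounds 0 and C on the two edges gives |D| ≤ 0^{1-t} C^t = 0 at
height tβ for 0 < t < 1, and continuity reaches t = 1. -/
theorem eq_zero_of_forall_real_eq_zero {β : ℝ} {D : ℂ → ℂ} (hc : ContinuousOn D (strip β))
    {C : ℝ} (hb : ∀ z ∈ strip β, ‖D z‖ ≤ C) (hd : DifferentiableOn ℂ D (interior (strip β)))
    (h0 : ∀ t : ℝ, D t = 0) : D (β * Complex.I) = 0 := by
  rcases eq_or_ne β 0 with rfl | hβ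
  · simpa using h0 0
  have hβI : (β * Complex.I : ℂ) ≠ 0 := mul_ne_zero (Complex.ofReal_ne_zero.2 hβ) Complex.I_ne_zero
  -- Multiplication by iβ carries the vertical strip 0 ≤ Re w ≤ 1 to the given strip for either sign
  -- of β, with Re w = 0 going to the real axis.
  have hmaps : MapsTo (fun w : ℂ => β * Complex.I * w)
      (Complex.HadamardThreeLines.verticalClosedStrip 0 1) (strip β) := by
    intro w hw
    obtain ⟨hw0, hw1⟩ : 0 ≤ w.re ∧ w.re ≤ 1 := hw
    have him : (β * Complex.I * w : ℂ).im = β * w.re := by simp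
    change (β * Complex.I * w : ℂ).im ∈ Set.uIcc 0 β
    rw [him, Set.mem_uIcc]
    rcases le_total 0 β with h | h
    · left; constructor <;> nlinarith
    · right; constructor <;> nlinarith
  have hcl : IsClosed (Complex.HadamardThreeLines.verticalClosedStrip 0 1) :=
    isClosed_Icc.preimage Complex.continuous_re
  have hop : IsOpen (Complex.HadamardThreeLines.verticalStrip 0 1) :=
    isOpen_Ioo.preimage Complex.continuous_re
  have hsub : Complex.HadamardThreeLines.verticalStrip 0 1 ⊆
      Complex.HadamardThreeLines.verticalClosedStrip 0 1 :=
    preimage_mono Ioo_subset_Icc_self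
  have hmaps' : MapsTo (fun w : ℂ => β * Complex.I * w)
      (Complex.HadamardThreeLines.verticalStrip 0 1) (interior (strip β)) := by
    refine mapsTo_iff_image_subset.2 (interior_maximal ?_ ?_)
    · exact (hmaps.mono_left hsub).image_subset
    · exact (Homeomorph.mulLeft₀ _ hβI).isOpenMap _ hop
  have hcont : ContinuousOn (fun w : ℂ => D (β * Complex.I * w))
      (Complex.HadamardThreeLines.verticalClosedStrip 0 1) :=
    hc.comp (by fun_prop) hmaps
  have hdc : DiffContOnCl ℂ (fun w : ℂ => D (β * Complex.I * w))
      (Complex.HadamardThreeLines.verticalStrip 0 1) :=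
    ⟨hd.comp (by fun_prop) hmaps', hcont.mono (closure_minimal hsub hcl)⟩
  have hin : ∀ t : ℝ, t ∈ Ioo (0 : ℝ) 1 → D (β * Complex.I * t) = 0 := by
    intro t ht
    have := Complex.HadamardThreeLines.norm_le_interp_of_mem_verticalClosedStrip'
      (f := fun w : ℂ => D (β * Complex.I * w)) (z := t) (a := 0) (b := C) zero_lt_one
      (show (t : ℂ).re ∈ Icc (0 : ℝ) 1 from Ioo_subset_Icc_self ht) hdc ?_ ?_ ?_
    · rw [Complex.ofReal_re, Real.zero_rpow, zero_mul] at this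
      · exact norm_le_zero_iff.1 this
      · have := ht.2
        norm_num
        linarith
    · refine ⟨C, ?_⟩
      rintro _ ⟨w, hw, rfl⟩
      exact hb _ (hmaps hw)
    · intro w hw
      have hw0 : w.re = 0 := hw
      have e : (β * Complex.I * w : ℂ) = ((-(β * w.im) : ℝ) : ℂ) := by
        apply Complex.ext <;> simp [hw0]
      change ‖D (β * Complex.I * w)‖ ≤ 0
      rw [e, h0, norm_zero]
    · intro w hw
      have hw1 : w.re = 1 := hw
      exact hb _ (hmaps (show w.re ∈ Icc (0 : ℝ) 1 by rw [hw1]; simp))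
  have hline : ContinuousOn (fun t : ℝ => D (β * Complex.I * t)) (Icc 0 1) :=
    hcont.comp (f := fun t : ℝ => (t : ℂ)) (by fun_prop) fun t ht => by
      change (t : ℂ).re ∈ Icc (0 : ℝ) 1
      simpa using ht
  have := EqOn.of_subset_closure (g := fun _ => (0 : ℂ)) hin hline continuousOn_const
    Ioo_subset_Icc_self (closure_Ioo (zero_ne_one (α := ℝ))).ge
    (show (1 : ℝ) ∈ Icc (0 : ℝ) 1 by simp)
  simpa using this

end CStarWeight

/-! ### Invariance, additivity and lower semicontinuity of the weight -/

namespace CStarWeight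

variable {A : Type*} [NonUnitalCStarAlgebra A]

theorem OneParamGroup.aut_star (α : OneParamGroup A) (t : ℝ) (a : A) :
    α.aut t (star a) = star (α.aut t a) :=
  map_star _ _

theorem OneParamGroup.aut_star_mul_self (α : OneParamGroup A) (t : ℝ) (a : A) :
    α.aut t (star a * a) = star (α.aut t a) * α.aut t a := by
  rw [map_mul, map_star]

theorem posCone_subset_closure_of_dense {ψ : A → ℝ≥0∞} (h : Dense (N ψ)) :
    posCone A ⊆ closure {a | a ∈ posCone A ∧ ψ a < ∞} := by
  rintro _ ⟨b, rfl⟩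
  have hc : Continuous fun a : A => star a * a := continuous_star.mul continuous_id
  exact map_mem_closure (f := fun a : A => star a * a) hc (h b) fun a ha => ⟨⟨a, rfl⟩, ha⟩

end CStarWeight

namespace EtaleGroupoid

open CStarWeight

variable {G X : Type*} [TopologicalSpace G] [TopologicalSpace X] {𝒢 : EtaleGroupoid G X}

theorem ContHom.map_unit (c : 𝒢.ContHom) (x : X) : c.toFun (𝒢.unit x) = 0 := by
  have h := c.map_inv_mul (𝒢.unit x) (𝒢.unit x) rfl
  rw [𝒢.inv_mul, 𝒢.s_unit, sub_self] at h
  exact h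

theorem ContHom.phaseLin_delta_unit (c : 𝒢.ContHom) (t : ℝ) (x : X) :
    c.phaseLin t (delta (𝒢.unit x)) = delta (𝒢.unit x) := by
  classical
  ext g
  rw [ContHom.phaseLin_apply, delta_apply]
  split_ifs with h
  · rw [h, c.map_unit]; simp
  · simp

theorem coeff_sigma (c : 𝒢.ContHom) (t : ℝ) (a : 𝒢.CstarR) (g : G) :
    𝒢.coeff (c.sigma.aut t a) g = Complex.exp (Complex.I * t * c.toFun g) * 𝒢.coeff a g := by
  have h : 𝒢.coeff (c.sigma.aut t a) g =
      c.conjAut t (a : L2 G →L[ℂ] L2 G) (delta (𝒢.unit (𝒢.s g))) g := rfl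
  rw [h, ContHom.conjAut_apply, c.phaseLin_delta_unit, ContHom.phaseLin_apply]
  rfl

/-- A homomorphism to ℝ vanishes on units, so the phase is 1 there. Invariance of the weight
therefore holds for every measure. -/
theorem condExp_sigma (c : 𝒢.ContHom) (t : ℝ) (a : 𝒢.CstarR) :
    𝒢.condExp (c.sigma.aut t a) = 𝒢.condExp a := by
  funext x
  rw [condExp_eq_coeff, condExp_eq_coeff, coeff_sigma, c.map_unit]
  simp

theorem weight_sigma [MeasurableSpace X] (m : Measure X) (c : 𝒢.ContHom) (t : ℝ) (a : 𝒢.CstarR) :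
    𝒢.weight m (c.sigma.aut t a) = 𝒢.weight m a := by
  rw [weight, weight, condExp_sigma]

theorem sigma_mem_N [MeasurableSpace X] (m : Measure X) (c : 𝒢.ContHom) (t : ℝ) {a : 𝒢.CstarR}
    (ha : a ∈ N (𝒢.weight m)) : c.sigma.aut t a ∈ N (𝒢.weight m) := by
  have h := 𝒢.weight_sigma m c t (star a * a)
  rw [OneParamGroup.aut_star_mul_self] at h
  exact lt_of_eq_of_lt h ha

theorem re_condExp_nonneg {a : 𝒢.CstarR} (ha : a ∈ posCone 𝒢.CstarR) (x : X) :
    0 ≤ (𝒢.condExp a x).re := by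
  obtain ⟨t, ht, h⟩ := 𝒢.exists_condExp_eq_ofReal ha x
  rw [h]
  simpa using ht

theorem continuous_condExp_apply (x : X) : Continuous fun a : 𝒢.CstarR => 𝒢.condExp a x :=
  𝒢.continuous_apply_delta _ _

variable [T2Space G] [LocallyCompactSpace G] [MeasurableSpace X] [BorelSpace X] (m : Measure X)

theorem measurable_ofReal_condExp (a : 𝒢.CstarR) :
    Measurable fun x => ENNReal.ofReal (𝒢.condExp a x).re :=
  (Complex.continuous_re.comp (𝒢.continuous_condExp a)).measurable.ennreal_ofReal

theorem isWeight_weight : IsWeight (𝒢.weight m) where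
  map_add a ha b hb := by
    rw [weight, weight, weight, ← lintegral_add_left (measurable_ofReal_condExp a)]
    refine lintegral_congr fun x => ?_
    rw [map_add, Pi.add_apply, Complex.add_re,
      ENNReal.ofReal_add (re_condExp_nonneg ha x) (re_condExp_nonneg hb x)]
  map_smul l hl a _ := by
    rw [weight, weight, ← lintegral_const_mul _ (measurable_ofReal_condExp a)]
    refine lintegral_congr fun x => ?_
    rw [𝒢.condExp.map_smul, Pi.smul_apply, smul_eq_mul, Complex.re_ofReal_mul,
      ENNReal.ofReal_mul hl.le]

/-- Norm convergence gives pointwise convergence of the expectations, and Fatou's lemma passes the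
bound to the limit. -/
theorem isClosed_weight_le (r : ℝ≥0) :
    IsClosed {a | a ∈ posCone 𝒢.CstarR ∧ 𝒢.weight m a ≤ r} := by
  refine IsSeqClosed.isClosed fun a b ha hab => ⟨?_, ?_⟩
  · exact isClosed_posCone.isSeqClosed (fun n => (ha n).1) hab
  · have hlim : ∀ x, Tendsto (fun n => ENNReal.ofReal (𝒢.condExp (a n) x).re) atTop
        (𝓝 (ENNReal.ofReal (𝒢.condExp b x).re)) := fun x =>
      ((ENNReal.continuous_ofReal.comp (Complex.continuous_re.comp
        (continuous_condExp_apply x))).tendsto b).comp hab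
    calc 𝒢.weight m b
        = ∫⁻ x, liminf (fun n => ENNReal.ofReal (𝒢.condExp (a n) x).re) atTop ∂m :=
          lintegral_congr fun x => ((hlim x).liminf_eq).symm
      _ ≤ liminf (fun n => 𝒢.weight m (a n)) atTop :=
          lintegral_liminf_le fun n => measurable_ofReal_condExp (a n)
      _ ≤ r := by
          refine liminf_le_of_le (by isBoundedDefault) fun C hC => ?_
          obtain ⟨n, hn⟩ := hC.exists
          exact hn.trans (ha n).2

variable [SecondCountableTopology G] [T2Space X]

/-- Inner regularity gives a compact `K` of positive measure. If `f` is 1 on the units over `K`,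
then P(f*f) ≥ 1 on `K`, since the unit contributes |f|² = 1 to the fibre sum. -/
theorem exists_weight_ne_zero [m.Regular] (hm : m ≠ 0) :
    ∃ a ∈ posCone 𝒢.CstarR, 𝒢.weight m a ≠ 0 := by
  have hpos : 0 < m univ := Measure.measure_univ_pos.2 hm
  obtain ⟨K, -, hK, hmK⟩ := isOpen_univ.exists_lt_isCompact hpos
  obtain ⟨χ, hχ1, -, hχc, -⟩ := exists_continuous_one_zero_of_isCompact
    (hK.image 𝒢.continuous_unit) isClosed_empty (disjoint_empty _)
  let f : C_c(G, ℂ) :=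
    { toFun := fun g => (χ g : ℂ)
      continuous_toFun := Complex.continuous_ofReal.comp χ.continuous
      hasCompactSupport' := hχc.comp_left (g := Complex.ofReal) Complex.ofReal_zero }
  refine ⟨_, star_mul_self_mem_posCone (𝒢.toCstarR f), ne_of_gt (hmK.trans_le ?_)⟩
  rw [← lintegral_indicator_one hK.measurableSet]
  refine lintegral_mono fun x => ?_
  by_cases hx : x ∈ K
  · rw [indicator_of_mem hx, ofReal_condExp_star_mul_self]
    let g₀ : {g : G // 𝒢.s g = x} := ⟨𝒢.unit x, 𝒢.s_unit x⟩
    refine le_trans (le_of_eq ?_)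
      (ENNReal.le_tsum (f := fun g : {g : G // 𝒢.s g = x} =>
        ‖𝒢.coeff (𝒢.toCstarR f) g‖ₑ ^ 2) g₀)
    have h1 : f (𝒢.unit x) = 1 := by
      change ((χ (𝒢.unit x) : ℝ) : ℂ) = 1
      rw [hχ1 (mem_image_of_mem _ hx), Pi.one_apply, Complex.ofReal_one]
    rw [coeff_toCstarR, h1]
    simp
  · rw [indicator_of_notMem hx]
    exact zero_le

/-! ### Properness and the KMS condition -/

variable [MeasurableSpace G] [BorelSpace G] (c : 𝒢.ContHom) (β : ℝ)

theorem dense_N_weight [IsFiniteMeasureOnCompacts m] : Dense (N (𝒢.weight m)) :=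
  𝒢.denseRange_toCstarR.mono (range_subset_iff.2 fun f => 𝒢.toCstarR_mem_N m f)

theorem isProper_weight [m.Regular] (hm : m ≠ 0) : IsProper (𝒢.weight m) where
  toIsWeight := isWeight_weight m
  nonzero := exists_weight_ne_zero m hm
  dense := posCone_subset_closure_of_dense (dense_N_weight m)
  lsc := isClosed_weight_le m

/-- The function b(g⁻¹) a(g) is μ_s-integrable. Inversion makes b(g) a(g⁻¹) integrable for μ_r, that
is, for e^{-βc} μ_s. -/
theorem integrable_exp_mul_coeff (h : 𝒢.rMeasure m = (𝒢.sMeasure m).withDensity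
      fun g => ENNReal.ofReal (Real.exp (-β * c.toFun g))) {a b : 𝒢.CstarR}
    (ha : a ∈ N (𝒢.weight m)) (hb : star b ∈ N (𝒢.weight m)) :
    Integrable (fun g => (Real.exp (-β * c.toFun g) : ℂ) *
      (𝒢.coeff a (𝒢.inv g) * 𝒢.coeff b g)) (𝒢.sMeasure m) := by
  have h1 := (𝒢.measurePreserving_inv m).integrable_comp_of_integrable
    (𝒢.integrable_coeff_mul m hb ha)
  rw [h, integrable_withDensity_iff_integrable_smul' (c.measurable_density (-β))
    (ae_of_all _ fun _ => ENNReal.ofReal_lt_top)] at h1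
  refine h1.congr (ae_of_all _ fun g => ?_)
  simp only [ENNReal.toReal_ofReal (Real.exp_pos _).le, Complex.real_smul, Function.comp_apply,
    inv_inv]
  ring

theorem isKMSWeight_weight [m.Regular] (hm : m ≠ 0)
    (h : 𝒢.rMeasure m = (𝒢.sMeasure m).withDensity
      fun g => ENNReal.ofReal (Real.exp (-β * c.toFun g))) :
    IsKMSWeight β c.sigma (𝒢.weight m) where
  toIsProper := isProper_weight m hm
  invariant t a _ := 𝒢.weight_sigma m c t a
  kms a b ha ha' hb hb' := by
    have hc := c.continuous_toFun.measurable
    have hw := 𝒢.integrable_coeff_mul m ha' hb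
    have hw' := integrable_exp_mul_coeff m c β h ha hb'
    -- The memberships of a* and b in 𝒩 give integrability on the real edge, and those of a and b*
    -- give it on the edge Im z = β.
    refine ⟨fun z => ∫ g, Complex.exp (Complex.I * z * c.toFun g) *
      (𝒢.coeff a (𝒢.inv g) * 𝒢.coeff b g) ∂(𝒢.sMeasure m),
      continuousOn_integral_exp hc hw hw', ⟨_, fun z hz => norm_integral_exp_le hw hw' hz⟩,
      differentiableOn_integral_exp hc hw hw', fun t => ⟨?_, ?_⟩⟩
    · rw [𝒢.ext_weight_mul m ha' (𝒢.sigma_mem_N m c t hb)]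
      refine integral_congr_ae (ae_of_all _ fun g => ?_)
      simp only [coeff_sigma]
      ring
    · have hs : star (c.sigma.aut t b) ∈ N (𝒢.weight m) := by
        rw [← OneParamGroup.aut_star]
        exact 𝒢.sigma_mem_N m c t hb'
      -- Inversion moves the integral to μ_r, and returning to μ_s produces the factor e^{-βc} by
      -- which e^{i(t+iβ)c} differs from e^{itc}.
      rw [𝒢.ext_weight_mul m hs ha, ← integral_rMeasure_eq_integral_inv,
        integral_rMeasure_eq c β m h]
      refine integral_congr_ae (ae_of_all _ fun g => ?_)
      simp only [coeff_sigma, inv_inv]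
      have e : Complex.exp (Complex.I * (t + β * Complex.I) * c.toFun g) =
          (Real.exp (-β * c.toFun g) : ℂ) * Complex.exp (Complex.I * t * c.toFun g) := by
        rw [Complex.ofReal_exp, ← Complex.exp_add]
        congr 1
        push_cast
        linear_combination (β * c.toFun g : ℂ) * Complex.I_mul_I
      rw [e]
      ring

theorem IsKMSWeight.ext_weight_mul_comm [IsFiniteMeasureOnCompacts m]
    (h : IsKMSWeight β c.sigma (𝒢.weight m)) (f g : C_c(G, ℂ)) :
    CStarWeight.ext (𝒢.weight m) (𝒢.toCstarR f * 𝒢.toCstarR g) =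
      CStarWeight.ext (𝒢.weight m)
        (𝒢.toCstarR g * 𝒢.toCstarR (c.twist (Complex.I * β) f)) := by
  -- The pair is taken in the order (g, f), so that F(t) = φ_m(g σ_t(f)) and F(iβ) = φ_m(fg).
  obtain ⟨F, hFc, ⟨C, hFb⟩, hFd, hF⟩ := h.kms (𝒢.toCstarR g) (𝒢.toCstarR f)
    (𝒢.toCstarR_mem_N m g) (𝒢.star_toCstarR_mem_N m g) (𝒢.toCstarR_mem_N m f)
    (𝒢.star_toCstarR_mem_N m f)
  have hE : ∀ z : ℂ, CStarWeight.ext (𝒢.weight m) (𝒢.toCstarR g * 𝒢.toCstarR (c.twist z f)) =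
      ∫ k, Complex.exp (Complex.I * z * c.toFun k) * (g (𝒢.inv k) * f k) ∂(𝒢.sMeasure m) := by
    intro z
    rw [ext_weight_toCstarR_mul]
    refine integral_congr_ae (ae_of_all _ fun k => ?_)
    simp only [ContHom.twist_apply]
    ring
  have hc := c.continuous_toFun
  have hgf : Continuous fun k => g (𝒢.inv k) * f k :=
    (g.continuous.comp 𝒢.continuous_inv).mul f.continuous
  have hw : Integrable (fun k => g (𝒢.inv k) * f k) (𝒢.sMeasure m) :=
    hgf.integrable_of_hasCompactSupport f.hasCompactSupport.mul_left
  -- No relation between μ_r and μ_s is available in this direction; the compact support of `f`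
  -- provides integrability instead.
  have hw' : Integrable (fun k => (Real.exp (-β * c.toFun k) : ℂ) * (g (𝒢.inv k) * f k))
      (𝒢.sMeasure m) := by
    refine Continuous.integrable_of_hasCompactSupport (by fun_prop) ?_
    exact HasCompactSupport.mul_left (f.hasCompactSupport.mul_left)
  have key := eq_zero_of_forall_real_eq_zero (β := β) (D := fun z => F z -
      ∫ k, Complex.exp (Complex.I * z * c.toFun k) * (g (𝒢.inv k) * f k) ∂(𝒢.sMeasure m))
    (hFc.sub (continuousOn_integral_exp hc.measurable hw hw'))
    (fun z hz => (norm_sub_le _ _).trans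
      (add_le_add (hFb z hz) (norm_integral_exp_le hw hw' hz)))
    (hFd.sub (differentiableOn_integral_exp hc.measurable hw hw')) (fun t => by
      rw [(hF t).1, ← hE]
      have : c.sigma.aut t (𝒢.toCstarR f) = 𝒢.toCstarR (c.twist t f) := c.sigmaAut_toCstarR t f
      rw [this, sub_self])
  have h0 := (hF 0).2
  rw [c.sigma.aut_zero, Complex.ofReal_zero, zero_add] at h0
  rw [← h0, mul_comm Complex.I, hE]
  exact sub_eq_zero.1 key

end EtaleGroupoid

theorem proposition2p1 {G X : Type*} [TopologicalSpace G] [T2Space G] [LocallyCompactSpace G]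
    [SecondCountableTopology G] [TopologicalSpace X] [MeasurableSpace X] [BorelSpace X]
    (𝒢 : EtaleGroupoid G X) (c : 𝒢.ContHom) (β : ℝ) (m : Measure X) [m.Regular] (hm : m ≠ 0) :
    List.TFAE [
      EtaleGroupoid.IsConformal c β m,
      ∀ f g : C_c(G, ℂ),
        𝒢.toCstarR f * 𝒢.toCstarR g ∈ CStarWeight.NstarN (𝒢.weight m) ∧
        𝒢.toCstarR g * 𝒢.toCstarR (c.twist (Complex.I * β) f) ∈
          CStarWeight.NstarN (𝒢.weight m) ∧
        CStarWeight.ext (𝒢.weight m) (𝒢.toCstarR f * 𝒢.toCstarR g) =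
          CStarWeight.ext (𝒢.weight m)
            (𝒢.toCstarR g * 𝒢.toCstarR (c.twist (Complex.I * β) f)),
      CStarWeight.IsKMSWeight β c.sigma (𝒢.weight m)] := by
  borelize G
  have := 𝒢.t2Space_unit
  -- The membership half of condition 2 holds for every such measure, since C_c(G) is contained in
  -- both 𝒩 and 𝒩*.
  have hmem : ∀ f g : C_c(G, ℂ),
      𝒢.toCstarR f * 𝒢.toCstarR g ∈ CStarWeight.NstarN (𝒢.weight m) := fun f g =>
    𝒢.mul_mem_NstarN m (𝒢.star_toCstarR_mem_N m f) (𝒢.toCstarR_mem_N m g)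
  tfae_have 1 → 3 := fun h => EtaleGroupoid.isKMSWeight_weight m c β hm
    ((EtaleGroupoid.sMeasure_eq_iff_rMeasure_eq c β m).1
      ((EtaleGroupoid.isConformal_iff_sMeasure_eq c β m).1 h))
  tfae_have 3 → 2 := fun h f g =>
    ⟨hmem _ _, hmem _ _, EtaleGroupoid.IsKMSWeight.ext_weight_mul_comm m c β h f g⟩
  tfae_have 2 → 1 := fun h => (EtaleGroupoid.isConformal_iff_sMeasure_eq c β m).2
    ((EtaleGroupoid.sMeasure_eq_iff_rMeasure_eq c β m).2
      ((EtaleGroupoid.rMeasure_eq_iff_ext_weight c β m).2 fun f g => (h f g).2.2))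
  tfae_finish
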